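/- Let $\mathbb L^3$ be $\mathbb R^3$ with the inner product $\langle x,y\rangle=-x_1y_1+x_2y_2+x_3y_3$. A congruence of $\mathbb L^3$ is a map $x\mapsto \Lambda x+b$ with $\Lambda$ linear and preserving $\langle\cdot,\cdot\rangle$; a surface $M$ is congruent to a part of $S$ if some congruence maps $M$ into $S$. **Theorem.** Let $J_1,J_2\subset\mathbb R$ be open intervals, let $\alpha,\beta:J_1\to\mathbb L^3$ be real analytic, and suppose that the ruled surface $X(t,s)=\alpha(t)+s\beta(t)$, $(t,s)\in J_1\times J_2$, is timelike (the induced metric has signature $(1,1)$ at every point) and minimal (its mean curvature vanishes identically). Then the surface $X(J_1\times J_2)$ is congruent to a part of one of the following surfaces: 1. a Lorentzian plane, i.e. an affine plane on which $\langle\cdot,\cdot\rangle$ has signature $(1,1)$; 2. a helicoid of the 1st kind $\frac1c(u,\ \sin v\cos u,\ \sin v\sin u)$, $u\in\mathbb R$, $|v|<\frac{\pi}{2}$, for some $c\neq0$; 3. a helicoid of the 2nd kind $\frac1c(\cosh v\sinh u,\ \cosh v\cosh u,\ u)$, $u\in\mathbb R$, $v>0$, for some $c\ne0$; 4. a helicoid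 of the 3rd kind $\frac1c(\sinh u\cosh v,\ v,\ \sinh u\sinh v)$, $u,v\in\mathbb R$, for some $c\neq0$; 5. the conjugate of Enneper's surface of the 2nd kind $-\frac1{6c}(3u+3uv^2+u^3,\ 3v^2+3u^2-3,\ 3u-3uv^2-u^3)$, $u\in\mathbb R$, $v>0$, for some $c\neq0$; 6. a flat $B$-scroll over an analytic null curve, i.e. a surface $\tilde\alpha(t)+sB(t)$, $t\in I$, $s\in\mathbb R$, where $I$ is an open interval, $\tilde\alpha:I\to\mathbb L^3$ is real analytic and has a frame $A=\tilde\alpha',B,C$ with $\langle A,A\rangle=\langle B,B\rangle=\langle A,C\rangle=\langle B,C\rangle=0$, $\langle A,B\rangle=\langle C,C\rangle=1$, $B'=0$ and $C'=-c(t)B$ for a real analytic function $c:I\to\mathbb R$ that is not identically zero. -/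

import Mathlib

namespace LorentzMinkowski

/-- The vector space underlying the Lorentz-Minkowski space `𝕃³`. -/
abbrev L3 : Type := Fin 3 → ℝ

/-- The Lorentzian inner product `-x₁y₁ + x₂y₂ + x₃y₃`. -/
def lor (x y : L3) : ℝ := -(x 0 * y 0) + x 1 * y 1 + x 2 * y 2

/-- The Lorentzian cross product. -/
def cross (u v : L3) : L3 :=
  ![u 2 * v 1 - u 1 * v 2, u 2 * v 0 - u 0 * v 2, u 0 * v 1 - u 1 * v 0]

/-- The cross product is characterized by `⟨u × v, w⟩ = det [u, v, w]`. -/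
theorem lor_cross (u v w : L3) : lor (cross u v) w = (Matrix.of ![u, v, w]).det := by
  simp [lor, cross, Matrix.det_fin_three]
  ring

/-- Congruences of `𝕃³`: affine maps whose linear part preserves the Lorentzian inner product. -/
def IsCongruence (φ : L3 → L3) : Prop :=
  ∃ (Λ : L3 →ₗ[ℝ] L3) (b : L3),
    (∀ x y, lor (Λ x) (Λ y) = lor x y) ∧ ∀ x, φ x = Λ x + b

/-- `M` is congruent to a part of `S`. -/
def CongruentToPart (M S : Set L3) : Prop :=
  ∃ φ : L3 → L3, IsCongruence φ ∧ φ '' M ⊆ S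

/-! Local geometry of a parametrized surface `X : (t, s) ↦ X t s`. -/

/-- The partial derivative of `X` in the first variable. -/
noncomputable def pdT (X : ℝ → ℝ → L3) : ℝ → ℝ → L3 := fun t s => deriv (fun t' => X t' s) t

/-- The partial derivative of `X` in the second variable. -/
noncomputable def pdS (X : ℝ → ℝ → L3) : ℝ → ℝ → L3 := fun t s => deriv (fun s' => X t s') s

/-- First fundamental form, coefficient `⟨X_t, X_t⟩`. -/
noncomputable def coefE (X : ℝ → ℝ → L3) (t s : ℝ) : ℝ := lor (pdT X t s) (pdT X t s)

/-- First fundamental form, coefficient `⟨X_t, X_s⟩`. -/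
noncomputable def coefF (X : ℝ → ℝ → L3) (t s : ℝ) : ℝ := lor (pdT X t s) (pdS X t s)

/-- First fundamental form, coefficient `⟨X_s, X_s⟩`. -/
noncomputable def coefG (X : ℝ → ℝ → L3) (t s : ℝ) : ℝ := lor (pdS X t s) (pdS X t s)

/-- `X` is timelike on `U`: the first fundamental form has signature `(1,1)` at every point of `U`.
In particular `X_t` and `X_s` are linearly independent there. -/
def IsTimelikeOn (X : ℝ → ℝ → L3) (U : Set (ℝ × ℝ)) : Prop :=
  ∀ p ∈ U, coefE X p.1 p.2 * coefG X p.1 p.2 - coefF X p.1 p.2 ^ 2 < 0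

/-- The unit normal `X_t × X_s / ‖X_t × X_s‖`, a spacelike unit vector where `X` is timelike. -/
noncomputable def unitNormal (X : ℝ → ℝ → L3) (t s : ℝ) : L3 :=
  (Real.sqrt (lor (cross (pdT X t s) (pdS X t s)) (cross (pdT X t s) (pdS X t s))))⁻¹ •
    cross (pdT X t s) (pdS X t s)

/-- The mean curvature: half the trace of the shape operator, in terms of the coefficients of the
first and second fundamental forms. -/
noncomputable def meanCurvature (X : ℝ → ℝ → L3) (t s : ℝ) : ℝ :=
  (lor (pdT (pdT X) t s) (unitNormal X t s) * coefG X t s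
      - 2 * (lor (pdS (pdT X) t s) (unitNormal X t s) * coefF X t s)
      + lor (pdS (pdS X) t s) (unitNormal X t s) * coefE X t s) /
    (2 * (coefE X t s * coefG X t s - coefF X t s ^ 2))

/-- `X` is minimal on `U`: its mean curvature vanishes at every point of `U`. -/
def IsMinimalOn (X : ℝ → ℝ → L3) (U : Set (ℝ × ℝ)) : Prop :=
  ∀ p ∈ U, meanCurvature X p.1 p.2 = 0

/-- The parametrization `X(t, s) = α(t) + s β(t)` with base curve `α` and director field `β`. -/
def ruled (α β : ℝ → L3) : ℝ → ℝ → L3 := fun t s => α t + s • β t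

/-- The point set `X(U)` traced out by a parametrized surface. -/
def surfaceOn (X : ℝ → ℝ → L3) (U : Set (ℝ × ℝ)) : Set L3 := (fun p : ℝ × ℝ => X p.1 p.2) '' U

/-! The model surfaces. -/

/-- Lorentzian planes: affine planes on which the inner product has signature `(1,1)`. -/
def IsLorentzianPlane (P : Set L3) : Prop :=
  ∃ p u v : L3, lor u u * lor v v - lor u v ^ 2 < 0 ∧
    P = {x | ∃ a b : ℝ, x = p + a • u + b • v}

/-- The timelike helicoid of the 1st kind, parametrized over its regular domain. -/
noncomputable def helicoid1 (c : ℝ) : Set L3 :=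
  surfaceOn (fun u v => (1 / c) • ![u, Real.sin v * Real.cos u, Real.sin v * Real.sin u])
    {p | p.2 ∈ Set.Ioo (-(Real.pi / 2)) (Real.pi / 2)}

/-- The timelike helicoid of the 2nd kind, parametrized over its regular domain. -/
noncomputable def helicoid2 (c : ℝ) : Set L3 :=
  surfaceOn (fun u v => (1 / c) • ![Real.cosh v * Real.sinh u, Real.cosh v * Real.cosh u, u])
    {p | 0 < p.2}

/-- The timelike helicoid of the 3rd kind. -/
noncomputable def helicoid3 (c : ℝ) : Set L3 :=
  surfaceOn (fun u v => (1 / c) • ![Real.sinh u * Real.cosh v, v, Real.sinh u * Real.sinh v])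
    Set.univ

/-- The conjugate of Enneper's timelike surface of the 2nd kind, parametrized over its regular
domain. -/
noncomputable def conjEnneper2 (c : ℝ) : Set L3 :=
  surfaceOn (fun u v => (-(1 / (6 * c))) •
      ![3 * u + 3 * u * v ^ 2 + u ^ 3, 3 * v ^ 2 + 3 * u ^ 2 - 3, 3 * u - 3 * u * v ^ 2 - u ^ 3])
    {p | 0 < p.2}

/-- `A, B, C` is a Cartan frame along the lightlike curve `α : I → 𝕃³`, with constant `a` and
function `c`. -/
structure IsCartanFrame (I : Set ℝ) (α A B C : ℝ → L3) (a : ℝ) (c : ℝ → ℝ) : Prop where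
  lor_A_A : ∀ t ∈ I, lor (A t) (A t) = 0
  lor_B_B : ∀ t ∈ I, lor (B t) (B t) = 0
  lor_A_B : ∀ t ∈ I, lor (A t) (B t) = 1
  lor_A_C : ∀ t ∈ I, lor (A t) (C t) = 0
  lor_B_C : ∀ t ∈ I, lor (B t) (C t) = 0
  lor_C_C : ∀ t ∈ I, lor (C t) (C t) = 1
  deriv_curve : ∀ t ∈ I, HasDerivAt α (A t) t
  deriv_C : ∀ t ∈ I, HasDerivAt C (-(a • A t) - c t • B t) t

/-- `S` is a flat `B`-scroll over an analytic null curve `α : I → 𝕃³`: the surface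
`α(t) + s B(t)`, `t ∈ I`, `s ∈ ℝ`, for a Cartan frame with analytic and not identically vanishing
function `c`, such that `B' = 0` and `C' = -c B`. -/
def IsFlatBScroll (S : Set L3) : Prop :=
  ∃ (I : Set ℝ) (α A B C : ℝ → L3) (a : ℝ) (c : ℝ → ℝ),
    IsOpen I ∧ I.OrdConnected ∧
    AnalyticOnNhd ℝ α I ∧ AnalyticOnNhd ℝ c I ∧ (∃ t ∈ I, c t ≠ 0) ∧
    IsCartanFrame I α A B C a c ∧
    (∀ t ∈ I, HasDerivAt B 0 t) ∧ (∀ t ∈ I, HasDerivAt C (-(c t • B t)) t) ∧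
    S = surfaceOn (ruled α B) (I ×ˢ Set.univ)

end LorentzMinkowski

open LorentzMinkowski

namespace LorentzMinkowski

open Filter Topology Set

/-! ### Analytic functions of one real variable -/

/-! For `X = α + s β` one has `X_ss = 0` and `X_st = β'`, so the numerator of the mean curvature is,
up to a nonzero factor, a quadratic polynomial in `s`. Its three coefficients vanish for each `t`,
which gives the equations of `MinimalRuled`. Everything else is extracted from them, local
identities being spread over the interval by the identity theorem.

If `β × β' = 0` throughout, the rulings are parallel (`cylinder`). For a non-null ruling direction
`e`, minimality makes `e × α'` parallel to its derivative, so the normal direction is constant and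
the surface is planar. For a null direction the surface is a graph over a null coordinate; it is
either planar or a flat `B`-scroll, whose null base curve comes from one integration
(`scroll_of_normalized`).

Otherwise `β` is not identically null (`dir_not_null`), and since analytic functions on an interval
have no zero divisors, the leading coefficient gives `det(β', β, β'') = 0`. Thus `β × β'` keeps a
fixed direction `m`, and all directors are orthogonal to `m` (`exists_normal`). Either `α'` is
orthogonal to `m` as well and the surface is planar, or some point is generic.

Near a generic point, use a coordinate `x₀` that vanishes on the directors. The coefficient of `s`
says that the direction of `β` turns at a rate proportional to that of `x₀` (`exists_wronskian_eq`).
The constant coefficient determines the motion of a point on each ruling (`hasDerivAt_striction`).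
If `m` is not null, this point projects to a fixed point, so all rulings meet an axis and the
surface is a helicoid. If `m` is null, it moves along a parabola and a cubic in `x₀`, which gives
the conjugate of Enneper's surface. The causal characters of `m` and `β` select the model
(`generic_cases`), and the fact that a timelike surface has a spacelike normal confines the
parameter to the stated domain. -/

theorem eventually_eq_of_hasDerivAt_zero {f : ℝ → ℝ} {t₀ : ℝ}
    (h : ∀ᶠ t in 𝓝 t₀, HasDerivAt f 0 t) : ∀ᶠ t in 𝓝 t₀, f t = f t₀ := by
  obtain ⟨ε, hε, hb⟩ := Metric.eventually_nhds_iff_ball.1 h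
  filter_upwards [Metric.ball_mem_nhds t₀ hε] with t ht
  exact Metric.isOpen_ball.is_const_of_deriv_eq_zero (convex_ball t₀ ε).isPreconnected
    (fun x hx => (hb x hx).differentiableAt.differentiableWithinAt)
    (fun x hx => (hb x hx).deriv) ht (Metric.mem_ball_self hε)

theorem eqOn_of_eventually_eq {J : Set ℝ} {f g : ℝ → ℝ} {t₀ : ℝ} (hJ : IsPreconnected J)
    (hf : AnalyticOnNhd ℝ f J) (hg : AnalyticOnNhd ℝ g J) (ht₀ : t₀ ∈ J)
    (h : ∀ᶠ t in 𝓝 t₀, f t = g t) : ∀ t ∈ J, f t = g t :=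
  hf.eqOn_of_preconnected_of_eventuallyEq hg hJ ht₀ h

/-- Integrate the power series term by term: dividing the `k`-th coefficient by `k + 1` does not
shrink the radius of convergence. -/
theorem exists_hasDerivAt_of_analyticAt {f : ℝ → ℝ} {x : ℝ} (hf : AnalyticAt ℝ f x) :
    ∃ F : ℝ → ℝ, AnalyticAt ℝ F x ∧ ∀ᶠ t in 𝓝 x, HasDerivAt F (f t) t := by
  obtain ⟨p, r, hp⟩ := hf
  set c : ℕ → ℝ := fun n => Nat.casesOn n 0 (fun k => p.coeff k / (k + 1)) with hc
  set q : FormalMultilinearSeries ℝ ℝ ℝ := FormalMultilinearSeries.ofScalars ℝ c with hq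
  have hr : r ≤ q.radius := by
    refine hp.r_le.trans ?_
    refine ENNReal.le_of_forall_nnreal_lt fun s hs => ?_
    obtain ⟨C, hC, hCb⟩ := p.norm_mul_pow_le_of_lt_radius hs
    refine q.le_radius_of_bound (C * s) fun n => ?_
    rw [hq, FormalMultilinearSeries.ofScalars_norm]
    cases n with
    | zero => simp [hc]; positivity
    | succ k =>
      have h1 := hCb k
      have h2 : ‖c (k + 1)‖ ≤ ‖p k‖ := by
        simp only [hc, norm_div]
        have h3 : ‖p.coeff k‖ = ‖p k‖ := by simp
        rw [h3]
        refine div_le_self (norm_nonneg _) ?_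
        rw [Real.norm_of_nonneg (by positivity)]
        linarith [(Nat.cast_nonneg k : (0:ℝ) ≤ k)]
      calc ‖c (k + 1)‖ * (s : ℝ) ^ (k + 1) ≤ ‖p k‖ * (s : ℝ) ^ (k + 1) := by gcongr
        _ = ‖p k‖ * (s : ℝ) ^ k * s := by ring
        _ ≤ C * s := by gcongr
  have hF0 := (q.hasFPowerSeriesOnBall (hp.r_pos.trans_le hr)).mono hp.r_pos hr
  have hF : HasFPowerSeriesOnBall (fun z => q.sum (z - x)) q x r := by
    simpa using hF0.comp_sub x
  refine ⟨_, hF.analyticAt, ?_⟩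
  filter_upwards [Metric.eball_mem_nhds x hp.r_pos] with t ht
  have hd : DifferentiableAt ℝ (fun z => q.sum (z - x)) t :=
    (hF.analyticAt_of_mem ht).differentiableAt
  suffices h : f t = deriv (fun z => q.sum (z - x)) t from h ▸ hd.hasDerivAt
  have hy : t - x ∈ Metric.eball (0 : ℝ) r := by
    simpa [edist_eq_enorm_sub] using ht
  have h1 := hp.hasSum hy
  have h2 := (hF.fderiv.hasSum hy).mapL (ContinuousLinearMap.apply ℝ ℝ (1 : ℝ))
  simp only [add_sub_cancel] at h1 h2
  have h4 : (fun n => (p n) fun _ => t - x) =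
      fun n => ContinuousLinearMap.apply ℝ ℝ (1 : ℝ) (q.derivSeries n fun _ => t - x) := by
    funext n
    have h3 : q.coeff (n + 1) = p.coeff n / (n + 1) := by
      rw [hq, FormalMultilinearSeries.coeff_ofScalars]
    have := q.derivSeries_coeff_one n
    simp only [FormalMultilinearSeries.apply_eq_pow_smul_coeff, map_smul,
      ContinuousLinearMap.apply_apply, this, h3, nsmul_eq_mul, smul_eq_mul]
    push_cast
    field_simp
  rw [h4] at h1
  rw [← fderiv_apply_one_eq_deriv]
  exact h1.unique h2

/-- Locally `F` differs by a constant from the primitive given by the integrated power series. -/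
theorem analyticAt_of_hasDerivAt {f F : ℝ → ℝ} {x : ℝ} (hf : AnalyticAt ℝ f x)
    (hF : ∀ᶠ t in 𝓝 x, HasDerivAt F (f t) t) : AnalyticAt ℝ F x := by
  obtain ⟨G, hG, hG'⟩ := exists_hasDerivAt_of_analyticAt hf
  have h := eventually_eq_of_hasDerivAt_zero (f := fun t => F t - G t) (t₀ := x) <| by
    filter_upwards [hF, hG'] with t h1 h2
    exact (sub_self (f t)) ▸ h1.sub h2
  refine (hG.add (analyticAt_const (v := F x - G x))).congr ?_
  filter_upwards [h] with t ht
  simp only [Pi.add_apply]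
  linarith

theorem exists_primitive {J : Set ℝ} (hJo : IsOpen J) (hJ : J.OrdConnected) {f : ℝ → ℝ}
    (hf : AnalyticOnNhd ℝ f J) :
    ∃ F : ℝ → ℝ, AnalyticOnNhd ℝ F J ∧ ∀ t ∈ J, HasDerivAt F (f t) t := by
  rcases J.eq_empty_or_nonempty with rfl | ⟨t₀, ht₀⟩
  · exact ⟨0, by simp [AnalyticOnNhd], by simp⟩
  have hd : ∀ t ∈ J, HasDerivAt (fun t => ∫ x in t₀..t, f x) (f t) t := fun t ht => by
    refine intervalIntegral.integral_hasDerivAt_right ?_ ?_ (hf t ht).continuousAt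
    · exact (hf.continuousOn.mono (hJ.uIcc_subset ht₀ ht)).intervalIntegrable
    · exact hf.continuousOn.stronglyMeasurableAtFilter hJo t ht
  exact ⟨_, fun t ht => analyticAt_of_hasDerivAt (hf t ht)
    ((hJo.eventually_mem ht).mono fun s hs => hd s hs), hd⟩

/-! ### Algebra of the Lorentzian inner product -/

theorem lor_comm (x y : L3) : lor x y = lor y x := by simp only [lor]; ring

theorem lor_add_left (x y z : L3) : lor (x + y) z = lor x z + lor y z := by
  simp only [lor, Pi.add_apply]; ring

theorem lor_add_right (x y z : L3) : lor x (y + z) = lor x y + lor x z := by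
  simp only [lor, Pi.add_apply]; ring

theorem lor_sub_right (x y z : L3) : lor x (y - z) = lor x y - lor x z := by
  simp only [lor, Pi.sub_apply]; ring

theorem lor_smul_left (a : ℝ) (x y : L3) : lor (a • x) y = a * lor x y := by
  simp only [lor, Pi.smul_apply, smul_eq_mul]; ring

theorem lor_smul_right (a : ℝ) (x y : L3) : lor x (a • y) = a * lor x y := by
  simp only [lor, Pi.smul_apply, smul_eq_mul]; ring

theorem vec_ext {x y : L3} (h0 : x 0 = y 0) (h1 : x 1 = y 1) (h2 : x 2 = y 2) : x = y := by
  ext i; fin_cases i <;> assumption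

theorem cross_apply_zero (u v : L3) : cross u v 0 = u 2 * v 1 - u 1 * v 2 := rfl
theorem cross_apply_one (u v : L3) : cross u v 1 = u 2 * v 0 - u 0 * v 2 := rfl
theorem cross_apply_two (u v : L3) : cross u v 2 = u 0 * v 1 - u 1 * v 0 := rfl

/-- The determinant of three vectors. -/
def vol (u v w : L3) : ℝ := lor (cross u v) w

/-- The Gram determinant of two vectors. -/
def gram (u v : L3) : ℝ := lor u u * lor v v - lor u v ^ 2

theorem lor_cross_self (u v : L3) : lor (cross u v) (cross u v) = -gram u v := by
  simp only [lor, cross_apply_zero, cross_apply_one, cross_apply_two, gram]; ring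

theorem lor_cross_left (u v : L3) : lor (cross u v) u = 0 := by
  simp only [lor, cross_apply_zero, cross_apply_one, cross_apply_two]; ring

theorem lor_cross_right (u v : L3) : lor (cross u v) v = 0 := by
  simp only [lor, cross_apply_zero, cross_apply_one, cross_apply_two]; ring

/-- The right side is minus the Gram determinant of the three vectors; the sign is the determinant
of the Lorentzian form. -/
theorem vol_sq (u v w : L3) : vol u v w ^ 2 =
    -(lor u u * (lor v v * lor w w - lor v w ^ 2) - lor u v * (lor u v * lor w w - lor v w * lor u w)
      + lor u w * (lor u v * lor v w - lor v v * lor u w)) := by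
  simp only [lor, cross_apply_zero, cross_apply_one, cross_apply_two, vol]; ring

/-- Expansion of a vector in the basis `u, v, u × v`. -/
theorem gram_smul (n u v : L3) : gram u v • n = (lor n u * lor v v - lor n v * lor u v) • u +
    (lor n v * lor u u - lor n u * lor u v) • v - lor n (cross u v) • cross u v := by
  apply vec_ext <;>
  simp only [lor, cross_apply_zero, cross_apply_one, cross_apply_two, gram, Pi.add_apply,
    Pi.sub_apply, Pi.smul_apply, smul_eq_mul] <;> ring

theorem cross_cross_cross (u v w : L3) : cross (cross u v) (cross u w) = (-vol u v w) • u := by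
  apply vec_ext <;>
  simp only [vol, lor, cross_apply_zero, cross_apply_one, cross_apply_two,
    Pi.smul_apply, smul_eq_mul] <;> ring

theorem eq_smul_of_cross_eq_zero {x y : L3} (hx : x ≠ 0) (h : cross x y = 0) :
    ∃ k : ℝ, y = k • x := by
  have h0 := congrFun h 0
  have h1 := congrFun h 1
  have h2 := congrFun h 2
  simp only [cross_apply_zero, cross_apply_one, cross_apply_two, Pi.zero_apply] at h0 h1 h2
  have : x 0 ≠ 0 ∨ x 1 ≠ 0 ∨ x 2 ≠ 0 := by
    by_contra! hc
    exact hx (vec_ext hc.1 hc.2.1 hc.2.2)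
  rcases this with h | h | h
  · refine ⟨y 0 / x 0, vec_ext ?_ ?_ ?_⟩ <;> simp only [Pi.smul_apply, smul_eq_mul] <;>
      field_simp <;> linarith
  · refine ⟨y 1 / x 1, vec_ext ?_ ?_ ?_⟩ <;> simp only [Pi.smul_apply, smul_eq_mul] <;>
      field_simp <;> linarith
  · refine ⟨y 2 / x 2, vec_ext ?_ ?_ ?_⟩ <;> simp only [Pi.smul_apply, smul_eq_mul] <;>
      field_simp <;> linarith

theorem eq_zero_of_normal {n u v : L3} (h : gram u v < 0) (hu : lor n u = 0) (hv : lor n v = 0)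
    (hN : lor n (cross u v) = 0) : n = 0 := by
  have := gram_smul n u v
  simp only [hu, hv, hN, zero_mul, sub_zero, zero_smul, add_zero] at this
  exact (smul_eq_zero.1 this).resolve_left h.ne

/-- By the expansion `gram_smul`, `n` is a multiple of `u × v`, whose square is `-gram u v > 0`. -/
theorem lor_self_pos_of_normal {n u v : L3} (h : gram u v < 0) (hn : n ≠ 0) (hu : lor n u = 0)
    (hv : lor n v = 0) : 0 < lor n n := by
  have hN : lor n (cross u v) ≠ 0 := fun hN => hn (eq_zero_of_normal h hu hv hN)
  have := congrArg (lor n) (gram_smul n u v)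
  simp only [hu, hv, zero_mul, sub_zero, zero_smul, add_zero, zero_sub, ← neg_smul,
    lor_smul_right] at this
  have h2 : 0 < lor n (cross u v) ^ 2 := by positivity
  nlinarith

theorem exists_eq_add_of_normal {n u v y : L3} (h : gram u v < 0) (hn : n ≠ 0) (hu : lor n u = 0)
    (hv : lor n v = 0) (hy : lor n y = 0) : ∃ a b : ℝ, y = a • u + b • v := by
  have hN : lor n (cross u v) ≠ 0 := fun hN => hn (eq_zero_of_normal h hu hv hN)
  have h1 := congrArg (fun z => lor z y) (gram_smul n u v)
  have hy' : lor y (cross u v) = 0 := by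
    simp only [hu, hv, zero_mul, sub_zero, zero_smul, add_zero, zero_sub, lor_smul_left, hy,
      mul_zero] at h1
    have h2 : lor (-(lor n (cross u v) • cross u v)) y
        = -(lor n (cross u v) * lor y (cross u v)) := by
      rw [← neg_smul, lor_smul_left, lor_comm (cross u v) y]; ring
    rw [h2] at h1
    have h3 : lor n (cross u v) * lor y (cross u v) = 0 := by linarith
    exact (mul_eq_zero.1 h3).resolve_left hN
  have h2 := gram_smul y u v
  rw [hy', zero_smul, sub_zero] at h2
  refine ⟨(gram u v)⁻¹ * (lor y u * lor v v - lor y v * lor u v),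
    (gram u v)⁻¹ * (lor y v * lor u u - lor y u * lor u v), ?_⟩
  rw [mul_smul, mul_smul, ← smul_add, ← h2, inv_smul_smul₀ h.ne]

/-! ### Lorentz maps -/

/-- Linear maps preserving the Lorentzian inner product. -/
def IsLorentz (Λ : L3 →ₗ[ℝ] L3) : Prop := ∀ x y, lor (Λ x) (Λ y) = lor x y

theorem IsLorentz.gram {Λ : L3 →ₗ[ℝ] L3} (h : IsLorentz Λ) (u v : L3) :
    gram (Λ u) (Λ v) = gram u v := by
  simp only [LorentzMinkowski.gram, h _ _]

/-- The factor is the determinant of `Λ`. It cannot vanish, since `Λ` preserves the Gram determinant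
of the standard basis. The minimality equations are homogeneous in `vol`, so a common nonzero factor
is all that is needed. -/
theorem IsLorentz.vol {Λ : L3 →ₗ[ℝ] L3} (h : IsLorentz Λ) :
    ∃ d : ℝ, d ≠ 0 ∧ ∀ u v w, vol (Λ u) (Λ v) (Λ w) = d * vol u v w := by
  obtain ⟨M, hM⟩ : ∃ M : Matrix (Fin 3) (Fin 3) ℝ, ∀ x i, Λ x i = ∑ j, x j * M i j :=
    ⟨LinearMap.toMatrix' Λ, fun x i => by
      conv_lhs => rw [← Matrix.toLin'_toMatrix' Λ, Matrix.toLin'_apply]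
      simp [Matrix.mulVec, dotProduct, mul_comm]⟩
  have key : ∀ u v w, LorentzMinkowski.vol (Λ u) (Λ v) (Λ w) =
      M.det * LorentzMinkowski.vol u v w := fun u v w => by
    simp only [LorentzMinkowski.vol, lor_cross]
    rw [← Matrix.det_transpose M, mul_comm, ← Matrix.det_mul]
    congr 1
    ext i j
    fin_cases i <;> simp [Matrix.mul_apply, hM]
  refine ⟨_, fun hd => ?_, key⟩
  have h1 := vol_sq (Λ ![1, 0, 0]) (Λ ![0, 1, 0]) (Λ ![0, 0, 1])
  have h' : ∀ x y, lor (Λ x) (Λ y) = lor x y := h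
  rw [key, hd, zero_mul] at h1
  simp only [h'] at h1
  simp [lor] at h1

/-- A Lorentz orthonormal frame defines a Lorentz map, the change to its coordinates. -/
theorem exists_isLorentz_of_frame {E₀ E₁ E₂ : L3} (h00 : lor E₀ E₀ = -1) (h11 : lor E₁ E₁ = 1)
    (h22 : lor E₂ E₂ = 1) (h01 : lor E₀ E₁ = 0) (h02 : lor E₀ E₂ = 0) (h12 : lor E₁ E₂ = 0) :
    ∃ Λ : L3 →ₗ[ℝ] L3, IsLorentz Λ ∧
      ∀ x, Λ x 0 = -lor E₀ x ∧ Λ x 1 = lor E₁ x ∧ Λ x 2 = lor E₂ x := by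
  refine ⟨{ toFun := fun x => ![-lor E₀ x, lor E₁ x, lor E₂ x], map_add' := ?_, map_smul' := ?_ },
    ?_, fun x => ⟨rfl, rfl, rfl⟩⟩
  · intro x y
    apply vec_ext <;> simp [lor_add_right]
    ring
  · intro a x
    apply vec_ext <;> simp [lor_smul_right]
  · let M : Matrix (Fin 3) (Fin 3) ℝ := !![E₀ 0, -E₀ 1, -E₀ 2; -E₁ 0, E₁ 1, E₁ 2; -E₂ 0, E₂ 1, E₂ 2]
    let N : Matrix (Fin 3) (Fin 3) ℝ := !![E₀ 0, E₁ 0, E₂ 0; E₀ 1, E₁ 1, E₂ 1; E₀ 2, E₁ 2, E₂ 2]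
    have hMN : M * N = 1 := by
      simp only [lor] at h00 h11 h22 h01 h02 h12
      ext i j
      fin_cases i <;> fin_cases j <;> simp [M, N, Matrix.mul_apply, Fin.sum_univ_three] <;>
        linarith
    -- `M * N = 1` is orthonormality of the frame. The reversed product is the completeness
    -- relation, which is what makes the coordinate map preserve the form.
    have hNM : N * M = 1 := mul_eq_one_comm.1 hMN
    have e : ∀ i j, (N * M) i j = (1 : Matrix (Fin 3) (Fin 3) ℝ) i j := fun i j => by rw [hNM]
    have e00 := e 0 0
    have e01 := e 0 1
    have e02 := e 0 2
    have e11 := e 1 1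
    have e12 := e 1 2
    have e22 := e 2 2
    simp [M, N, Matrix.mul_apply, Fin.sum_univ_three] at e00 e01 e02 e11 e12 e22
    intro x y
    simp [lor]
    linear_combination (-(x 0 * y 0)) * e00 + (-(x 0 * y 1) - x 1 * y 0) * e01
      + (-(x 0 * y 2) - x 2 * y 0) * e02 + x 1 * y 1 * e11 + (x 1 * y 2 + x 2 * y 1) * e12
      + x 2 * y 2 * e22

/-- A null vector can be rotated to a multiple of `(1, 0, -1)`. -/
theorem exists_isLorentz_of_null {e : L3} (he : e ≠ 0) (hee : lor e e = 0) :
    ∃ Λ : L3 →ₗ[ℝ] L3, IsLorentz Λ ∧ ∃ k : ℝ, k ≠ 0 ∧ Λ e = k • ![1, 0, -1] := by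
  have h0 : e 0 ≠ 0 := fun h0 => by
    simp only [lor, h0] at hee
    refine he (vec_ext h0 ?_ ?_) <;> simp only [Pi.zero_apply] <;> nlinarith
  have hee' : e 1 ^ 2 + e 2 ^ 2 = e 0 ^ 2 := by simp only [lor] at hee; linarith
  -- The time axis is kept. `E₂` is minus the spatial part of `e` divided by `e 0`, a unit vector
  -- because `e` is null, and `E₁` is orthogonal to it.
  obtain ⟨Λ, hΛ, hx⟩ := exists_isLorentz_of_frame (E₀ := ![1, 0, 0])
    (E₁ := ![0, e 2 / e 0, -(e 1 / e 0)]) (E₂ := ![0, -(e 1 / e 0), -(e 2 / e 0)])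
    (by simp [lor]) (by simp [lor]; field_simp; linarith) (by simp [lor]; field_simp; linarith)
    (by simp [lor]) (by simp [lor]) (by simp [lor]; ring)
  refine ⟨Λ, hΛ, e 0, h0, vec_ext ?_ ?_ ?_⟩
  · rw [(hx e).1]; simp [lor]
  · rw [(hx e).2.1]; simp [lor]; ring
  · rw [(hx e).2.2]; simp [lor]; field_simp; linarith

/-! ### Congruences -/

theorem CongruentToPart.comp {M M' S : Set L3} (h : CongruentToPart M' S) {φ : L3 → L3}
    (hφ : IsCongruence φ) (hM : φ '' M ⊆ M') : CongruentToPart M S := by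
  obtain ⟨ψ, ⟨Λ, b, hΛ, hψ⟩, hS⟩ := h
  obtain ⟨Λ', b', hΛ', hφ'⟩ := hφ
  refine ⟨ψ ∘ φ, ⟨Λ ∘ₗ Λ', Λ b' + b, fun x y => ?_, fun x => ?_⟩, ?_⟩
  · simp [hΛ, hΛ']
  · simp [hψ, hφ', add_assoc]
  · rw [image_comp]
    exact (image_mono hM).trans hS

theorem congruentToPart_of_subset {M S : Set L3} (h : M ⊆ S) : CongruentToPart M S :=
  ⟨id, ⟨LinearMap.id, 0, by simp, by simp⟩, by simpa using h⟩

theorem congruentToPart_of_sub {M S : Set L3} (b : L3) (h : ∀ x ∈ M, x - b ∈ S) :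
    CongruentToPart M S :=
  ⟨fun x => x - b, ⟨LinearMap.id, -b, by simp, by simp [sub_eq_add_neg]⟩, by
    rintro _ ⟨x, hx, rfl⟩; exact h x hx⟩

/-! ### Calculus with the Lorentzian product -/

theorem hasDerivAt_apply {u : ℝ → L3} {u' : L3} {t : ℝ} (h : HasDerivAt u u' t) (i : Fin 3) :
    HasDerivAt (fun t => u t i) (u' i) t := hasDerivAt_pi.1 h i

theorem hasDerivAt_vec {u : ℝ → L3} {u' : L3} {t : ℝ} (h0 : HasDerivAt (fun t => u t 0) (u' 0) t)
    (h1 : HasDerivAt (fun t => u t 1) (u' 1) t) (h2 : HasDerivAt (fun t => u t 2) (u' 2) t) :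
    HasDerivAt u u' t :=
  hasDerivAt_pi.2 fun i => by fin_cases i <;> assumption

theorem _root_.HasDerivAt.cross {u v : ℝ → L3} {u' v' : L3} {t : ℝ} (hu : HasDerivAt u u' t)
    (hv : HasDerivAt v v' t) :
    HasDerivAt (fun t => cross (u t) (v t)) (cross u' (v t) + cross (u t) v') t := by
  have hu := hasDerivAt_apply hu
  have hv := hasDerivAt_apply hv
  refine hasDerivAt_vec ?_ ?_ ?_ <;>
  simp only [cross_apply_zero, cross_apply_one, cross_apply_two, Pi.add_apply]
  · exact (((hu 2).mul (hv 1)).sub ((hu 1).mul (hv 2))).congr_deriv (by ring)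
  · exact (((hu 2).mul (hv 0)).sub ((hu 0).mul (hv 2))).congr_deriv (by ring)
  · exact (((hu 0).mul (hv 1)).sub ((hu 1).mul (hv 0))).congr_deriv (by ring)

theorem _root_.HasDerivAt.lor {u v : ℝ → L3} {u' v' : L3} {t : ℝ} (hu : HasDerivAt u u' t)
    (hv : HasDerivAt v v' t) :
    HasDerivAt (fun t => lor (u t) (v t)) (lor u' (v t) + lor (u t) v') t := by
  have hu := hasDerivAt_apply hu
  have hv := hasDerivAt_apply hv
  simp only [LorentzMinkowski.lor]
  exact (((((hu 0).mul (hv 0)).neg).add ((hu 1).mul (hv 1))).add ((hu 2).mul (hv 2))).congr_deriv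
    (by ring)

theorem _root_.HasDerivAt.linearMap {u : ℝ → L3} {u' : L3} {t : ℝ} (Λ : L3 →ₗ[ℝ] L3)
    (hu : HasDerivAt u u' t) : HasDerivAt (fun t => Λ (u t)) (Λ u') t :=
  Λ.toContinuousLinearMap.hasFDerivAt.comp_hasDerivAt t hu

theorem _root_.AnalyticOnNhd.comp_apply {u : ℝ → L3} {J : Set ℝ} (h : AnalyticOnNhd ℝ u J)
    (i : Fin 3) : AnalyticOnNhd ℝ (fun t => u t i) J := analyticOnNhd_pi_iff.1 h i

theorem analyticOnNhd_vec {u : ℝ → L3} {J : Set ℝ} (h0 : AnalyticOnNhd ℝ (fun t => u t 0) J)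
    (h1 : AnalyticOnNhd ℝ (fun t => u t 1) J) (h2 : AnalyticOnNhd ℝ (fun t => u t 2) J) :
    AnalyticOnNhd ℝ u J :=
  analyticOnNhd_pi_iff.2 fun i => by fin_cases i <;> assumption

theorem _root_.AnalyticOnNhd.cross {u v : ℝ → L3} {J : Set ℝ} (hu : AnalyticOnNhd ℝ u J)
    (hv : AnalyticOnNhd ℝ v J) : AnalyticOnNhd ℝ (fun t => cross (u t) (v t)) J := by
  have hu := hu.comp_apply
  have hv := hv.comp_apply
  exact analyticOnNhd_vec (((hu 2).mul (hv 1)).sub ((hu 1).mul (hv 2)))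
    (((hu 2).mul (hv 0)).sub ((hu 0).mul (hv 2))) (((hu 0).mul (hv 1)).sub ((hu 1).mul (hv 0)))

theorem _root_.AnalyticOnNhd.lor {u v : ℝ → L3} {J : Set ℝ} (hu : AnalyticOnNhd ℝ u J)
    (hv : AnalyticOnNhd ℝ v J) : AnalyticOnNhd ℝ (fun t => lor (u t) (v t)) J := by
  have hu := hu.comp_apply
  have hv := hv.comp_apply
  exact ((((hu 0).mul (hv 0)).neg).add ((hu 1).mul (hv 1))).add ((hu 2).mul (hv 2))

theorem _root_.AnalyticOnNhd.linearMap {u : ℝ → L3} {J : Set ℝ} (Λ : L3 →ₗ[ℝ] L3)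
    (hu : AnalyticOnNhd ℝ u J) : AnalyticOnNhd ℝ (fun t => Λ (u t)) J := fun t ht =>
  (Λ.toContinuousLinearMap.analyticAt _).comp (hu t ht)

/-- A vector function parallel to its derivative has constant direction. -/
theorem cross_eq_zero_of_parallel {J : Set ℝ} (hJo : IsOpen J) (hJ : IsPreconnected J)
    {v v' : ℝ → L3} (hv : AnalyticOnNhd ℝ v J) (hd : ∀ t ∈ J, HasDerivAt v (v' t) t)
    (hc : ∀ t ∈ J, cross (v t) (v' t) = 0) {t₁ : ℝ} (ht₁ : t₁ ∈ J) (hv₁ : v t₁ ≠ 0) :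
    ∀ t ∈ J, cross (v t₁) (v t) = 0 := by
  obtain ⟨i, hi⟩ : ∃ i, v t₁ i ≠ 0 := by
    by_contra! h
    exact hv₁ (funext h)
  have hne : ∀ᶠ t in 𝓝 t₁, v t i ≠ 0 := (hv.comp_apply i t₁ ht₁).continuousAt.eventually_ne hi
  have hJe : ∀ᶠ t in 𝓝 t₁, t ∈ J := hJo.eventually_mem ht₁
  have hcomp : ∀ t ∈ J, ∀ j k, v t j * v' t k = v t k * v' t j := fun t ht j k => by
    have h0 := congrFun (hc t ht) 0
    have h1 := congrFun (hc t ht) 1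
    have h2 := congrFun (hc t ht) 2
    simp only [cross_apply_zero, cross_apply_one, cross_apply_two, Pi.zero_apply] at h0 h1 h2
    fin_cases j <;> fin_cases k <;> simp only [Fin.zero_eta, Fin.mk_one, Fin.reduceFinMk] <;>
      linarith
  -- The ratios of the coordinates are constant near `t₁`, where coordinate `i` does not vanish.
  -- Clearing denominators lets the identity pass zeros of `v` by analyticity.
  have hj : ∀ j, ∀ t ∈ J, v t j * v t₁ i = v t₁ j * v t i := fun j => by
    refine eqOn_of_eventually_eq hJ ((hv.comp_apply j).mul analyticOnNhd_const)
      (analyticOnNhd_const.mul (hv.comp_apply i)) ht₁ ?_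
    have h := eventually_eq_of_hasDerivAt_zero (f := fun t => v t j / v t i) (t₀ := t₁) <| by
      filter_upwards [hne, hJe] with t h1 h2
      refine ((hasDerivAt_apply (hd t h2) j).div (hasDerivAt_apply (hd t h2) i) h1).congr_deriv ?_
      rw [div_eq_zero_iff]
      left
      linarith [hcomp t h2 j i]
    filter_upwards [h, hne] with t h1 h2
    rw [div_eq_div_iff h2 hi] at h1
    exact h1
  intro t ht
  have := fun j k => show v t₁ j * v t k = v t₁ k * v t j from by
    have h1 := hj j t ht
    have h2 := hj k t ht
    have : v t₁ i * (v t₁ j * v t k) = v t₁ i * (v t₁ k * v t j) := by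
      linear_combination v t₁ j * h2 - v t₁ k * h1
    exact mul_left_cancel₀ hi this
  apply vec_ext <;>
    simp only [cross_apply_zero, cross_apply_one, cross_apply_two, Pi.zero_apply, sub_eq_zero,
      this]

/-! ### Ruled surfaces with planar directors in adapted coordinates -/

/-- The equations of a minimal ruled surface `α + s β` in linear coordinates in which the director
field has vanishing coordinate `0`. The inner product is `β₁² + δ β₂²` on directors, and `ω`
measures how far the coordinate `0` is from being orthogonal to them. -/
structure AdaptedRuled (J : Set ℝ) (δ ω : ℝ) (α α₁ α₂ β β₁ β₂ : ℝ → L3) : Prop where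
  isOpen : IsOpen J
  isPreconnected : IsPreconnected J
  an_α : AnalyticOnNhd ℝ α J
  an_α₁ : AnalyticOnNhd ℝ α₁ J
  an_β : AnalyticOnNhd ℝ β J
  an_β₁ : AnalyticOnNhd ℝ β₁ J
  deriv_α : ∀ t ∈ J, HasDerivAt α (α₁ t) t
  deriv_α₁ : ∀ t ∈ J, HasDerivAt α₁ (α₂ t) t
  deriv_β : ∀ t ∈ J, HasDerivAt β (β₁ t) t
  deriv_β₁ : ∀ t ∈ J, HasDerivAt β₁ (β₂ t) t
  dir : ∀ t ∈ J, β t 0 = 0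
  ne_zero : ∀ t ∈ J, β t ≠ 0
  eq_one : ∀ t ∈ J, (β t 1 ^ 2 + δ * β t 2 ^ 2) *
      (α₁ t 0 * (β t 1 * β₂ t 2 - β t 2 * β₂ t 1) - α₂ t 0 * (β t 1 * β₁ t 2 - β t 2 * β₁ t 1)) =
    α₁ t 0 * (β t 1 * β₁ t 2 - β t 2 * β₁ t 1) * (2 * (β t 1 * β₁ t 1 + δ * (β t 2 * β₁ t 2)))
  eq_zero : ∀ t ∈ J, (β t 1 ^ 2 + δ * β t 2 ^ 2) *
      (α₁ t 0 * (β t 1 * α₂ t 2 - β t 2 * α₂ t 1) - α₂ t 0 * (β t 1 * α₁ t 2 - β t 2 * α₁ t 1)) =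
    2 * (α₁ t 0 * (β t 1 * β₁ t 2 - β t 2 * β₁ t 1)) *
      (α₁ t 1 * β t 1 + δ * (α₁ t 2 * β t 2) - ω * (α₁ t 0 * β t 2))

/-- A point at which an adapted ruled surface is generic. -/
structure IsGeneric (δ : ℝ) (α₁ β β₁ : ℝ → L3) (t : ℝ) : Prop where
  transverse : α₁ t 0 ≠ 0
  wronskian : β t 1 * β₁ t 2 - β t 2 * β₁ t 1 ≠ 0
  norm : β t 1 ^ 2 + δ * β t 2 ^ 2 ≠ 0

namespace AdaptedRuled

variable {J : Set ℝ} {δ ω : ℝ} {α α₁ α₂ β β₁ β₂ : ℝ → L3}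

theorem eventually_isGeneric (h : AdaptedRuled J δ ω α α₁ α₂ β β₁ β₂) {t₀ : ℝ} (ht₀ : t₀ ∈ J)
    (hg : IsGeneric δ α₁ β β₁ t₀) : ∀ᶠ t in 𝓝 t₀, t ∈ J ∧ IsGeneric δ α₁ β β₁ t := by
  have ha := fun i => (h.an_α₁.comp_apply i t₀ ht₀).continuousAt
  have hb := fun i => (h.an_β.comp_apply i t₀ ht₀).continuousAt
  have hb' := fun i => (h.an_β₁.comp_apply i t₀ ht₀).continuousAt
  filter_upwards [h.isOpen.eventually_mem ht₀, (ha 0).eventually_ne hg.transverse,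
    (((hb 1).mul (hb' 2)).sub ((hb 2).mul (hb' 1))).eventually_ne hg.wronskian,
    (((hb 1).pow 2).add (((hb 2).pow 2).const_mul δ)).eventually_ne hg.norm] with t h0 h1 h2 h3
  exact ⟨h0, h1, h2, h3⟩

/-- The field `eq_one` is the vanishing of the numerator in the quotient rule for the ratio of the
two sides. Geometrically, the directors turn at constant rate with respect to the height `α t 0`. -/
theorem exists_wronskian_eq (h : AdaptedRuled J δ ω α α₁ α₂ β β₁ β₂) {t₀ : ℝ} (ht₀ : t₀ ∈ J)
    (hg : IsGeneric δ α₁ β β₁ t₀) : ∃ κ : ℝ, κ ≠ 0 ∧ ∀ t ∈ J,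
      β t 1 * β₁ t 2 - β t 2 * β₁ t 1 = κ * (α₁ t 0 * (β t 1 ^ 2 + δ * β t 2 ^ 2)) := by
  have hc := eventually_eq_of_hasDerivAt_zero (f := fun t => (β t 1 * β₁ t 2 - β t 2 * β₁ t 1) /
    (α₁ t 0 * (β t 1 ^ 2 + δ * β t 2 ^ 2))) (t₀ := t₀) <| by
    filter_upwards [h.eventually_isGeneric ht₀ hg] with t ht
    obtain ⟨ht, hgt⟩ := ht
    have da := hasDerivAt_apply (h.deriv_α₁ t ht)
    have db := hasDerivAt_apply (h.deriv_β t ht)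
    have db' := hasDerivAt_apply (h.deriv_β₁ t ht)
    have dw := ((db 1).mul (db' 2)).sub ((db 2).mul (db' 1))
    have dg := (da 0).mul (((db 1).pow 2).add (((db 2).pow 2).const_mul δ))
    refine (dw.div dg (mul_ne_zero hgt.transverse hgt.norm)).congr_deriv ?_
    rw [div_eq_zero_iff]
    left
    simp only [Pi.mul_apply, Pi.sub_apply, Pi.add_apply, Pi.pow_apply]
    push_cast
    linear_combination h.eq_one t ht
  refine ⟨(β t₀ 1 * β₁ t₀ 2 - β t₀ 2 * β₁ t₀ 1) / (α₁ t₀ 0 * (β t₀ 1 ^ 2 + δ * β t₀ 2 ^ 2)),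
    div_ne_zero hg.wronskian (mul_ne_zero hg.transverse hg.norm), ?_⟩
  have ha := h.an_α₁.comp_apply
  have hb := h.an_β.comp_apply
  have hb' := h.an_β₁.comp_apply
  refine eqOn_of_eventually_eq h.isPreconnected
    (((hb 1).mul (hb' 2)).sub ((hb 2).mul (hb' 1)))
    (analyticOnNhd_const.mul ((ha 0).mul (((hb 1).pow 2).add
      (analyticOnNhd_const.mul ((hb 2).pow 2))))) ht₀ ?_
  filter_upwards [hc, h.eventually_isGeneric ht₀ hg] with t h1 h2
  exact (div_eq_iff (mul_ne_zero h2.2.transverse h2.2.norm)).1 h1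

/-- The parameter `σ` such that the derivative of `α - σ β` is proportional to `β` up to the
transverse direction. -/
noncomputable def striction (α₁ β β₁ : ℝ → L3) (t : ℝ) : ℝ :=
  (β t 1 * α₁ t 2 - β t 2 * α₁ t 1) / (β t 1 * β₁ t 2 - β t 2 * β₁ t 1)

/-- Subtracting `σ β` removes the `β'`-component of the projected velocity, so only a multiple of
`β` remains, and minimality fixes that multiple. It vanishes for `ω = 0`. -/
theorem hasDerivAt_striction (h : AdaptedRuled J δ ω α α₁ α₂ β β₁ β₂) {t : ℝ} (ht : t ∈ J)
    (hg : IsGeneric δ α₁ β β₁ t) :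
    HasDerivAt (fun t => α t 1 - striction α₁ β β₁ t * β t 1)
      (2 * ω * α₁ t 0 * β t 2 / (β t 1 ^ 2 + δ * β t 2 ^ 2) * β t 1) t ∧
    HasDerivAt (fun t => α t 2 - striction α₁ β β₁ t * β t 2)
      (2 * ω * α₁ t 0 * β t 2 / (β t 1 ^ 2 + δ * β t 2 ^ 2) * β t 2) t := by
  have da := hasDerivAt_apply (h.deriv_α t ht)
  have da' := hasDerivAt_apply (h.deriv_α₁ t ht)
  have db := hasDerivAt_apply (h.deriv_β t ht)
  have db' := hasDerivAt_apply (h.deriv_β₁ t ht)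
  have dw := ((db 1).mul (db' 2)).sub ((db 2).mul (db' 1))
  have dL := ((db 1).mul (da' 2)).sub ((db 2).mul (da' 1))
  have dσ : HasDerivAt (striction α₁ β β₁) _ t := dL.div dw hg.wronskian
  have hw := hg.wronskian
  have hn := hg.norm
  set a := α₁ t 0
  set w := β t 1 * β₁ t 2 - β t 2 * β₁ t 1 with hwdef
  set g := β t 1 ^ 2 + δ * β t 2 ^ 2 with hgdef
  set L := β t 1 * α₁ t 2 - β t 2 * α₁ t 1 with hL
  set L' := β t 1 * α₂ t 2 - β t 2 * α₂ t 1 with hL'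
  set M := β₁ t 1 * α₁ t 2 - β₁ t 2 * α₁ t 1 with hM
  set w' := β t 1 * β₂ t 2 - β t 2 * β₂ t 1 with hw'
  -- Eliminate the second derivative `α₂ t 0` between `eq_zero` and `eq_one`.
  have key : g * (-2 * M * w - L' * w + L * w') = 2 * ω * a * β t 2 * w ^ 2 := by
    refine mul_left_cancel₀ hg.transverse ?_
    linear_combination (-w) * h.eq_zero t ht + L * h.eq_one t ht
  have key' : 2 * ω * a * β t 2 / g = (-2 * M * w - L' * w + L * w') / w ^ 2 := by
    rw [div_eq_div_iff hn (pow_ne_zero 2 hw)]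
    linear_combination -key
  have hσ : striction α₁ β β₁ t = L / w := rfl
  replace dσ : HasDerivAt (striction α₁ β β₁) (((M + L') * w - L * w') / w ^ 2) t :=
    dσ.congr_deriv (by
      congr 1
      simp only [Pi.mul_apply, Pi.sub_apply]
      ring)
  -- Cramer's rule for the projection of `α'` in the basis `β, β'`.
  have h1 : α₁ t 1 * w = L * β₁ t 1 - M * β t 1 := by ring
  have h2 : α₁ t 2 * w = L * β₁ t 2 - M * β t 2 := by ring
  clear_value w L L' M w'
  rw [key']
  constructor
  · refine ((da 1).sub (dσ.mul (db 1))).congr_deriv ?_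
    rw [hσ]
    field_simp
    linear_combination w * h1
  · refine ((da 2).sub (dσ.mul (db 2))).congr_deriv ?_
    rw [hσ]
    field_simp
    linear_combination w * h2

/-- If the coordinate `0` is orthogonal to the directors, all rulings meet a line. -/
theorem exists_axis (h : AdaptedRuled J δ 0 α α₁ α₂ β β₁ β₂) {t₀ : ℝ} (ht₀ : t₀ ∈ J)
    (hg : IsGeneric δ α₁ β β₁ t₀) : ∃ Z₁ Z₂ : ℝ, ∀ t ∈ J,
      (α t 1 - Z₁) * β t 2 = (α t 2 - Z₂) * β t 1 := by
  have hev := h.eventually_isGeneric ht₀ hg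
  have h1 := eventually_eq_of_hasDerivAt_zero <| hev.mono fun t ht =>
    (h.hasDerivAt_striction ht.1 ht.2).1.congr_deriv (by simp)
  have h2 := eventually_eq_of_hasDerivAt_zero <| hev.mono fun t ht =>
    (h.hasDerivAt_striction ht.1 ht.2).2.congr_deriv (by simp)
  refine ⟨α t₀ 1 - striction α₁ β β₁ t₀ * β t₀ 1, α t₀ 2 - striction α₁ β β₁ t₀ * β t₀ 2, ?_⟩
  have ha := h.an_α.comp_apply
  have hb := h.an_β.comp_apply
  refine eqOn_of_eventually_eq h.isPreconnected
    (((ha 1).sub analyticOnNhd_const).mul (hb 2))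
    (((ha 2).sub analyticOnNhd_const).mul (hb 1)) ht₀ ?_
  filter_upwards [h1, h2] with t h1 h2
  linear_combination β t 2 * h1 - β t 1 * h2

/-- Implicit equation of the helicoids, together with its derivatives along the surface. The
functions `C` and `S` are `cos` and `sin` for `δ = 1`, and `cosh` and `sinh` for `δ = -1`. -/
theorem exists_helicoid_eq (h : AdaptedRuled J δ 0 α α₁ α₂ β β₁ β₂) {t₀ : ℝ} (ht₀ : t₀ ∈ J)
    (hg : IsGeneric δ α₁ β β₁ t₀) (h0 : β t₀ 2 = 0) {C S : ℝ → ℝ} (hC : ∀ x, AnalyticAt ℝ C x)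
    (hS : ∀ x, AnalyticAt ℝ S x) (dC : ∀ x, HasDerivAt C (-δ * S x) x)
    (dS : ∀ x, HasDerivAt S (C x) x) (hCS : ∀ x, C x ^ 2 + δ * S x ^ 2 = 1) (hS0 : S 0 = 0) :
    ∃ κ p₀ Z₁ Z₂ : ℝ, κ ≠ 0 ∧ ∀ t ∈ J, ∀ s : ℝ,
      β t 1 * S (κ * (α t 0 - p₀)) = β t 2 * C (κ * (α t 0 - p₀)) ∧
      (α t 1 + s * β t 1 - Z₁) * S (κ * (α t 0 - p₀)) =
        (α t 2 + s * β t 2 - Z₂) * C (κ * (α t 0 - p₀)) ∧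
      κ * ((α t 1 + s * β t 1 - Z₁) * C (κ * (α t 0 - p₀)) +
          δ * ((α t 2 + s * β t 2 - Z₂) * S (κ * (α t 0 - p₀)))) * α₁ t 0 +
        S (κ * (α t 0 - p₀)) * (α₁ t 1 + s * β₁ t 1) -
        C (κ * (α t 0 - p₀)) * (α₁ t 2 + s * β₁ t 2) = 0 := by
  obtain ⟨κ, hκ, hw⟩ := h.exists_wronskian_eq ht₀ hg
  obtain ⟨Z₁, Z₂, hZ⟩ := h.exists_axis ht₀ hg
  set θ : ℝ → ℝ := fun t => κ * (α t 0 - α t₀ 0) with hθ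
  have dθ : ∀ t ∈ J, HasDerivAt θ (κ * α₁ t 0) t := fun t ht =>
    ((hasDerivAt_apply (h.deriv_α t ht) 0).sub_const _).const_mul κ
  have dCθ : ∀ t ∈ J, HasDerivAt (fun t => C (θ t)) (-δ * S (θ t) * (κ * α₁ t 0)) t :=
    fun t ht => (dC (θ t)).comp t (dθ t ht)
  have dSθ : ∀ t ∈ J, HasDerivAt (fun t => S (θ t)) (C (θ t) * (κ * α₁ t 0)) t :=
    fun t ht => (dS (θ t)).comp t (dθ t ht)
  have aθ : AnalyticOnNhd ℝ θ J :=
    analyticOnNhd_const.mul ((h.an_α.comp_apply 0).sub analyticOnNhd_const)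
  have aC : AnalyticOnNhd ℝ (fun t => C (θ t)) J := fun t ht => (hC _).comp (aθ t ht)
  have aS : AnalyticOnNhd ℝ (fun t => S (θ t)) J := fun t ht => (hS _).comp (aθ t ht)
  have hb := h.an_β.comp_apply
  have hdir : ∀ t ∈ J, β t 1 * S (θ t) = β t 2 * C (θ t) := by
    refine eqOn_of_eventually_eq h.isPreconnected ((hb 1).mul aS) ((hb 2).mul aC) ht₀ ?_
    -- This quotient is homogeneous of degree zero in `β`; for `δ = 1` it is the squared sine of the
    -- angle between `β` and `(C θ, S θ)`. It is constant because both directions turn at the same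
    -- rate, and it vanishes at `t₀`.
    have hc := eventually_eq_of_hasDerivAt_zero (t₀ := t₀)
      (f := fun t => (β t 1 * S (θ t) - β t 2 * C (θ t)) ^ 2 / (β t 1 ^ 2 + δ * β t 2 ^ 2)) <| by
      filter_upwards [h.eventually_isGeneric ht₀ hg] with t ⟨ht, hgt⟩
      have db := hasDerivAt_apply (h.deriv_β t ht)
      have df := ((((db 1).mul (dSθ t ht)).sub ((db 2).mul (dCθ t ht))).pow 2).div
        (((db 1).pow 2).add (((db 2).pow 2).const_mul δ)) hgt.norm
      refine df.congr_deriv ?_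
      rw [div_eq_zero_iff]
      left
      simp only [Pi.mul_apply, Pi.sub_apply, Pi.add_apply, Pi.pow_apply]
      push_cast
      linear_combination (-2) * (β t 1 * S (θ t) - β t 2 * C (θ t)) *
        (β t 1 * C (θ t) + δ * (β t 2 * S (θ t))) * hw t ht
    filter_upwards [hc, h.eventually_isGeneric ht₀ hg] with t h1 ⟨ht, hgt⟩
    have hθ0 : θ t₀ = 0 := by simp [hθ]
    rw [hθ0, hS0, h0] at h1
    simp only [mul_zero, zero_mul, sub_zero, ne_eq, OfNat.ofNat_ne_zero, not_false_eq_true,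
      zero_pow, zero_div, div_eq_zero_iff, pow_eq_zero_iff, hgt.norm, or_false] at h1
    exact sub_eq_zero.1 h1
  have hsurf : ∀ t ∈ J, ∀ s : ℝ, (α t 1 + s * β t 1 - Z₁) * S (θ t) =
      (α t 2 + s * β t 2 - Z₂) * C (θ t) := fun t ht s => by
    -- With `e2`, this says `β = ρ (C θ, S θ)`. As `β` never vanishes, neither does `ρ`, so the axis
    -- equation can be divided by it.
    have e1 : (β t 1 * C (θ t) + δ * (β t 2 * S (θ t))) * C (θ t) = β t 1 := by
      linear_combination β t 1 * hCS (θ t) - δ * S (θ t) * hdir t ht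
    have e2 : (β t 1 * C (θ t) + δ * (β t 2 * S (θ t))) * S (θ t) = β t 2 := by
      linear_combination β t 2 * hCS (θ t) + C (θ t) * hdir t ht
    have hρ : β t 1 * C (θ t) + δ * (β t 2 * S (θ t)) ≠ 0 := fun h0 => by
      rw [h0, zero_mul] at e1 e2
      exact h.ne_zero t ht (vec_ext (h.dir t ht) e1.symm e2.symm)
    have : (α t 1 - Z₁) * S (θ t) = (α t 2 - Z₂) * C (θ t) := by
      refine mul_left_cancel₀ hρ ?_
      linear_combination hZ t ht + (α t 1 - Z₁) * e2 - (α t 2 - Z₂) * e1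
    linear_combination this + s * hdir t ht
  refine ⟨κ, α t₀ 0, Z₁, Z₂, hκ, fun t ht s => ⟨hdir t ht, hsurf t ht s, ?_⟩⟩
  have da := hasDerivAt_apply (h.deriv_α t ht)
  have db := hasDerivAt_apply (h.deriv_β t ht)
  have d1 := ((((da 1).add ((db 1).const_mul s)).sub_const Z₁).mul (dSθ t ht)).sub
    ((((da 2).add ((db 2).const_mul s)).sub_const Z₂).mul (dCθ t ht))
  have d2 := d1.unique ((hasDerivAt_const t (0 : ℝ)).congr_of_eventuallyEq <|
    (h.isOpen.eventually_mem ht).mono fun r hr => by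
      simp only [Pi.mul_apply, Pi.sub_apply, Pi.add_apply]
      linear_combination hsurf r hr s)
  simp only [Pi.add_apply] at d2
  linear_combination d2

/-- Implicit equation of the conjugate of Enneper's surface. -/
theorem exists_enneper_eq (h : AdaptedRuled J 0 (1 / 2) α α₁ α₂ β β₁ β₂) {t₀ : ℝ} (ht₀ : t₀ ∈ J)
    (hg : IsGeneric 0 α₁ β β₁ t₀) :
    ∃ κ p₀ Z₁ Z₂ : ℝ, κ ≠ 0 ∧ ∀ t ∈ J, ∀ s : ℝ,
      β t 2 = κ * (α t 0 - p₀) * β t 1 ∧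
      α t 2 + s * β t 2 - Z₂ = κ * (α t 0 - p₀) * (α t 1 + s * β t 1 - Z₁) -
        κ ^ 2 * (α t 0 - p₀) ^ 3 / 6 ∧
      α₁ t 2 + s * β₁ t 2 = (κ * (α t 1 + s * β t 1 - Z₁) - κ ^ 2 * (α t 0 - p₀) ^ 2 / 2) * α₁ t 0
        + κ * (α t 0 - p₀) * (α₁ t 1 + s * β₁ t 1) := by
  obtain ⟨κ, hκ, hw⟩ := h.exists_wronskian_eq ht₀ hg
  have hev := h.eventually_isGeneric ht₀ hg
  have hb1 : ∀ {t}, IsGeneric 0 α₁ β β₁ t → β t 1 ≠ 0 := fun hgt hb => by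
    have := hgt.norm
    simp [hb] at this
  have hslope := eventually_eq_of_hasDerivAt_zero (t₀ := t₀)
    (f := fun t => β t 2 / β t 1 - κ * α t 0) <| by
    filter_upwards [hev] with t ⟨ht, hgt⟩
    have da := hasDerivAt_apply (h.deriv_α t ht)
    have db := hasDerivAt_apply (h.deriv_β t ht)
    refine (((db 2).div (db 1) (hb1 hgt)).sub ((da 0).const_mul κ)).congr_deriv ?_
    have := hb1 hgt
    field_simp
    linear_combination hw t ht
  set p₀ := α t₀ 0 - β t₀ 2 / β t₀ 1 / κ with hp₀
  have hdir' : ∀ᶠ t in 𝓝 t₀, β t 2 = κ * (α t 0 - p₀) * β t 1 := by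
    filter_upwards [hslope, hev] with t h1 ⟨ht, hgt⟩
    have h2 : β t 2 / β t 1 = κ * (α t 0 - p₀) := by
      rw [hp₀]
      field_simp
      linear_combination h1
    rw [← h2, div_mul_cancel₀ _ (hb1 hgt)]
  have ha := h.an_α.comp_apply
  have hb := h.an_β.comp_apply
  have aQ : AnalyticOnNhd ℝ (fun t => α t 0 - p₀) J := (ha 0).sub analyticOnNhd_const
  have hdir : ∀ t ∈ J, β t 2 = κ * (α t 0 - p₀) * β t 1 :=
    eqOn_of_eventually_eq h.isPreconnected (hb 2) ((analyticOnNhd_const.mul aQ).mul (hb 1)) ht₀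
      hdir'
  -- With slope `β₂/β₁ = κ Q`, where `Q = α₀ - p₀`, the shifted point has velocity `(κ Q Q', κ² Q²
  -- Q')`. Integration gives `κ Q²/2` and, in `hγ2`, `κ² Q³/3`.
  have hγ1 := eventually_eq_of_hasDerivAt_zero (t₀ := t₀)
    (f := fun t => α t 1 - striction α₁ β β₁ t * β t 1 - κ / 2 * (α t 0 - p₀) ^ 2) <| by
    filter_upwards [hev] with t ⟨ht, hgt⟩
    have da := hasDerivAt_apply (h.deriv_α t ht)
    refine ((h.hasDerivAt_striction ht hgt).1.sub
      ((((da 0).sub_const p₀).pow 2).const_mul (κ / 2))).congr_deriv ?_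
    have := hb1 hgt
    rw [hdir t ht]
    field_simp
    ring
  have hγ2 := eventually_eq_of_hasDerivAt_zero (t₀ := t₀)
    (f := fun t => α t 2 - striction α₁ β β₁ t * β t 2 - κ ^ 2 / 3 * (α t 0 - p₀) ^ 3) <| by
    filter_upwards [hev] with t ⟨ht, hgt⟩
    have da := hasDerivAt_apply (h.deriv_α t ht)
    refine ((h.hasDerivAt_striction ht hgt).2.sub
      ((((da 0).sub_const p₀).pow 3).const_mul (κ ^ 2 / 3))).congr_deriv ?_
    have := hb1 hgt
    rw [hdir t ht]
    field_simp
    ring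
  obtain ⟨Z₁, hZ₁⟩ : ∃ Z₁ : ℝ, ∀ᶠ t in 𝓝 t₀,
    α t 1 - striction α₁ β β₁ t * β t 1 - κ / 2 * (α t 0 - p₀) ^ 2 = Z₁ := ⟨_, hγ1⟩
  obtain ⟨Z₂, hZ₂⟩ : ∃ Z₂ : ℝ, ∀ᶠ t in 𝓝 t₀,
    α t 2 - striction α₁ β β₁ t * β t 2 - κ ^ 2 / 3 * (α t 0 - p₀) ^ 3 = Z₂ := ⟨_, hγ2⟩
  -- Eliminating the striction parameter leaves an identity between functions analytic on all of
  -- `J`; the cubic coefficient is `1/3 - 1/2 = -1/6`.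
  have hbase : ∀ t ∈ J, α t 2 - Z₂ =
      κ * (α t 0 - p₀) * (α t 1 - Z₁) - κ ^ 2 / 6 * (α t 0 - p₀) ^ 3 := by
    refine eqOn_of_eventually_eq h.isPreconnected ((ha 2).sub analyticOnNhd_const)
      (((analyticOnNhd_const.mul aQ).mul ((ha 1).sub analyticOnNhd_const)).sub
        (analyticOnNhd_const.mul (aQ.pow 3))) ht₀ ?_
    filter_upwards [hZ₁, hZ₂, hdir'] with t h1 h2 h3
    linear_combination h2 - κ * (α t 0 - p₀) * h1 + striction α₁ β β₁ t * h3
  have hsurf : ∀ t ∈ J, ∀ s : ℝ,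
      α t 2 + s * β t 2 - Z₂ = κ * (α t 0 - p₀) * (α t 1 + s * β t 1 - Z₁) -
        κ ^ 2 * (α t 0 - p₀) ^ 3 / 6 := fun t ht s => by
    linear_combination hbase t ht + s * hdir t ht
  refine ⟨κ, p₀, Z₁, Z₂, hκ, fun t ht s => ⟨hdir t ht, hsurf t ht s, ?_⟩⟩
  have da := hasDerivAt_apply (h.deriv_α t ht)
  have db := hasDerivAt_apply (h.deriv_β t ht)
  have d0 := (da 0).sub_const p₀
  have d1 := (((da 2).add ((db 2).const_mul s)).sub_const Z₂).sub
    (((d0.const_mul κ).mul (((da 1).add ((db 1).const_mul s)).sub_const Z₁)).sub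
      (((d0.pow 3).const_mul (κ ^ 2)).div_const 6))
  have d2 := d1.unique ((hasDerivAt_const t (0 : ℝ)).congr_of_eventuallyEq <|
    (h.isOpen.eventually_mem ht).mono fun r hr => by
      simp only [Pi.mul_apply, Pi.sub_apply, Pi.add_apply, Pi.pow_apply]
      linear_combination hsurf r hr s)
  simp only [Pi.add_apply] at d2
  push_cast at d2
  linear_combination d2

end AdaptedRuled

/-! ### Minimal timelike ruled surfaces -/

/-- The conditions for `α + s β` to be timelike and minimal; the latter is expressed by the
vanishing of the coefficients of a polynomial in `s`. -/
structure MinimalRuled (J K : Set ℝ) (α α₁ α₂ β β₁ β₂ : ℝ → L3) : Prop where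
  isOpen : IsOpen J
  ordConnected : J.OrdConnected
  an_α : AnalyticOnNhd ℝ α J
  an_α₁ : AnalyticOnNhd ℝ α₁ J
  an_β : AnalyticOnNhd ℝ β J
  an_β₁ : AnalyticOnNhd ℝ β₁ J
  an_β₂ : AnalyticOnNhd ℝ β₂ J
  deriv_α : ∀ t ∈ J, HasDerivAt α (α₁ t) t
  deriv_α₁ : ∀ t ∈ J, HasDerivAt α₁ (α₂ t) t
  deriv_β : ∀ t ∈ J, HasDerivAt β (β₁ t) t
  deriv_β₁ : ∀ t ∈ J, HasDerivAt β₁ (β₂ t) t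
  timelike : ∀ t ∈ J, ∀ s ∈ K, gram (α₁ t + s • β₁ t) (β t) < 0
  eq_two : ∀ t ∈ J, lor (β t) (β t) * vol (β₁ t) (β t) (β₂ t) = 0
  eq_one : ∀ t ∈ J, lor (β t) (β t) * (vol (α₁ t) (β t) (β₂ t) - vol (α₂ t) (β t) (β₁ t)) =
    vol (α₁ t) (β t) (β₁ t) * (2 * lor (β t) (β₁ t))
  eq_zero : ∀ t ∈ J, lor (β t) (β t) * vol (α₁ t) (β t) (α₂ t) =
    2 * vol (α₁ t) (β t) (β₁ t) * lor (α₁ t) (β t)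

theorem eq_zero_of_hasDerivAt_of_eqOn_zero {J : Set ℝ} (hJ : IsOpen J) {f : ℝ → ℝ} {f' t : ℝ}
    (ht : t ∈ J) (hf : ∀ t ∈ J, f t = 0) (hd : HasDerivAt f f' t) : f' = 0 :=
  hd.unique ((hasDerivAt_const t (0 : ℝ)).congr_of_eventuallyEq ((hJ.eventually_mem ht).mono hf))

theorem lor_eq_zero_of_parallel {n m x : L3} (hn : n ≠ 0) (h : cross m n = 0) (hx : lor n x = 0) :
    lor m x = 0 := by
  have h' : cross n m = 0 := by
    have h0 := congrFun h 0
    have h1 := congrFun h 1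
    have h2 := congrFun h 2
    simp only [cross_apply_zero, cross_apply_one, cross_apply_two, Pi.zero_apply] at h0 h1 h2
    apply vec_ext <;> simp only [cross_apply_zero, cross_apply_one, cross_apply_two,
      Pi.zero_apply] <;> linarith
  obtain ⟨k, rfl⟩ := eq_smul_of_cross_eq_zero hn h'
  rw [lor_smul_left, hx, mul_zero]

namespace MinimalRuled

variable {J K : Set ℝ} {α α₁ α₂ β β₁ β₂ : ℝ → L3}

theorem isPreconnected (h : MinimalRuled J K α α₁ α₂ β β₁ β₂) : IsPreconnected J :=
  h.ordConnected.isPreconnected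

theorem map (h : MinimalRuled J K α α₁ α₂ β β₁ β₂) {Λ : L3 →ₗ[ℝ] L3} (hΛ : IsLorentz Λ) :
    MinimalRuled J K (fun t => Λ (α t)) (fun t => Λ (α₁ t)) (fun t => Λ (α₂ t))
      (fun t => Λ (β t)) (fun t => Λ (β₁ t)) (fun t => Λ (β₂ t)) := by
  obtain ⟨d, -, hd⟩ := hΛ.vol
  have hl : ∀ x y, lor (Λ x) (Λ y) = lor x y := hΛ
  refine ⟨h.isOpen, h.ordConnected, h.an_α.linearMap Λ, h.an_α₁.linearMap Λ, h.an_β.linearMap Λ,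
    h.an_β₁.linearMap Λ, h.an_β₂.linearMap Λ, fun t ht => (h.deriv_α t ht).linearMap Λ,
    fun t ht => (h.deriv_α₁ t ht).linearMap Λ, fun t ht => (h.deriv_β t ht).linearMap Λ,
    fun t ht => (h.deriv_β₁ t ht).linearMap Λ, fun t ht s hs => ?_, fun t ht => ?_, fun t ht => ?_,
    fun t ht => ?_⟩
  · rw [← map_smul, ← map_add, hΛ.gram]
    exact h.timelike t ht s hs
  · rw [hl, hd]
    linear_combination d * h.eq_two t ht
  · rw [hl, hl, hd, hd, hd]
    linear_combination d * h.eq_one t ht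
  · rw [hl, hl, hd, hd]
    linear_combination d * h.eq_zero t ht

theorem dir_ne_zero (h : MinimalRuled J K α α₁ α₂ β β₁ β₂) (hK : K.Nonempty) {t : ℝ} (ht : t ∈ J) :
    β t ≠ 0 := fun h0 => by
  obtain ⟨s, hs⟩ := hK
  have := h.timelike t ht s hs
  simp [gram, h0, lor] at this

theorem surface_map (Λ : L3 →ₗ[ℝ] L3) : Λ '' surfaceOn (ruled α β) (J ×ˢ K) =
    surfaceOn (ruled (fun t => Λ (α t)) (fun t => Λ (β t))) (J ×ˢ K) := by
  simp [surfaceOn, image_image, ruled]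

theorem congruentToPart_of_map {S : Set L3} {Λ : L3 →ₗ[ℝ] L3} (hΛ : IsLorentz Λ)
    (h : CongruentToPart (surfaceOn (ruled (fun t => Λ (α t)) (fun t => Λ (β t))) (J ×ˢ K)) S) :
    CongruentToPart (surfaceOn (ruled α β) (J ×ˢ K)) S :=
  h.comp (φ := Λ) ⟨Λ, 0, hΛ, by simp⟩ (surface_map Λ).subset

/-- A surface orthogonal to a fixed vector lies in a Lorentzian plane. -/
theorem planar (h : MinimalRuled J K α α₁ α₂ β β₁ β₂) (hJ : J.Nonempty) (hK : K.Nonempty) {m : L3}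
    (hm : m ≠ 0) (hα : ∀ t ∈ J, lor m (α₁ t) = 0) (hβ : ∀ t ∈ J, lor m (β t) = 0) :
    ∃ P, IsLorentzianPlane P ∧ CongruentToPart (surfaceOn (ruled α β) (J ×ˢ K)) P := by
  obtain ⟨t₀, ht₀⟩ := hJ
  obtain ⟨s₀, hs₀⟩ := hK
  have hβ₁ : ∀ t ∈ J, lor m (β₁ t) = 0 := fun t ht => by
    have := eq_zero_of_hasDerivAt_of_eqOn_zero h.isOpen ht hβ
      ((hasDerivAt_const t m).lor (h.deriv_β t ht))
    simpa [lor] using this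
  have hconst : ∀ t ∈ J, lor m (α t) = lor m (α t₀) := fun t ht =>
    h.isOpen.is_const_of_deriv_eq_zero (f := fun t => lor m (α t)) h.isPreconnected
      (fun x hx => ((hasDerivAt_const x m).lor
        (h.deriv_α x hx)).differentiableAt.differentiableWithinAt)
      (fun x hx => by
        have := ((hasDerivAt_const x m).lor (h.deriv_α x hx)).deriv
        rw [this, hα x hx]
        simp [lor]) ht ht₀
  have hg := h.timelike t₀ ht₀ s₀ hs₀
  refine ⟨_, ⟨α t₀, α₁ t₀ + s₀ • β₁ t₀, β t₀, hg, rfl⟩, congruentToPart_of_subset ?_⟩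
  rintro _ ⟨⟨t, s⟩, ⟨ht, -⟩, rfl⟩
  obtain ⟨a, b, hab⟩ := exists_eq_add_of_normal (y := α t + s • β t - α t₀) hg hm
    (by rw [lor_add_right, lor_smul_right, hα t₀ ht₀, hβ₁ t₀ ht₀]; simp) (hβ t₀ ht₀)
    (by rw [lor_sub_right, lor_add_right, lor_smul_right, hconst t ht, hβ t ht]; simp)
  refine ⟨a, b, ?_⟩
  rw [add_assoc, ← hab]
  simp [ruled]

/-- The normal of a timelike ruled surface is spacelike. -/
theorem normal_pos (h : MinimalRuled J K α α₁ α₂ β β₁ β₂) {t s : ℝ} (ht : t ∈ J) (hs : s ∈ K)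
    {n : L3} (hn : n ≠ 0) (h1 : lor n (α₁ t + s • β₁ t) = 0) (h2 : lor n (β t) = 0) :
    0 < lor n n :=
  lor_self_pos_of_normal (h.timelike t ht s hs) hn h1 h2

/-! ### Identification of the generic surfaces with the models -/

theorem helicoid1_of_normalized (h : MinimalRuled J K α α₁ α₂ β β₁ β₂) (hK : K.Nonempty)
    (h0 : ∀ t ∈ J, β t 0 = 0) {t₀ : ℝ} (ht₀ : t₀ ∈ J) (hβ : β t₀ 2 = 0)
    (hg : lor (β t₀) (β t₀) ≠ 0) (hD : vol (α₁ t₀) (β t₀) (β₁ t₀) ≠ 0) :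
    ∃ c, c ≠ 0 ∧ CongruentToPart (surfaceOn (ruled α β) (J ×ˢ K)) (helicoid1 c) := by
  have h1 : ∀ t ∈ J, β₁ t 0 = 0 := fun t ht =>
    eq_zero_of_hasDerivAt_of_eqOn_zero h.isOpen ht h0 (hasDerivAt_apply (h.deriv_β t ht) 0)
  have h2 : ∀ t ∈ J, β₂ t 0 = 0 := fun t ht =>
    eq_zero_of_hasDerivAt_of_eqOn_zero h.isOpen ht h1 (hasDerivAt_apply (h.deriv_β₁ t ht) 0)
  have had : AdaptedRuled J 1 0 α α₁ α₂ β β₁ β₂ := by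
    refine ⟨h.isOpen, h.isPreconnected, h.an_α, h.an_α₁, h.an_β, h.an_β₁, h.deriv_α, h.deriv_α₁,
      h.deriv_β, h.deriv_β₁, h0, fun t ht => h.dir_ne_zero hK ht, fun t ht => ?_, fun t ht => ?_⟩
    · have := h.eq_one t ht
      simp only [vol, lor, cross_apply_zero, cross_apply_one, cross_apply_two, h0 t ht, h1 t ht,
        h2 t ht] at this
      linear_combination this
    · have := h.eq_zero t ht
      simp only [vol, lor, cross_apply_zero, cross_apply_one, cross_apply_two, h0 t ht, h1 t ht]
        at this
      linear_combination this
  have hgen : IsGeneric 1 α₁ β β₁ t₀ := by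
    simp only [vol, lor, cross_apply_zero, cross_apply_one, cross_apply_two, h0 t₀ ht₀,
      h1 t₀ ht₀] at hg hD
    refine ⟨fun hc => hD ?_, fun hc => hD ?_, fun hc => hg ?_⟩
    · rw [hc]; ring
    · linear_combination α₁ t₀ 0 * hc
    · linear_combination hc
  obtain ⟨κ, p₀, Z₁, Z₂, hκ, hs⟩ := had.exists_helicoid_eq ht₀ hgen hβ
    (fun x => Real.analyticAt_cos) (fun x => Real.analyticAt_sin)
    (fun x => (Real.hasDerivAt_cos x).congr_deriv (by ring)) Real.hasDerivAt_sin
    (fun x => by linarith [Real.sin_sq_add_cos_sq x]) Real.sin_zero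
  refine ⟨κ, hκ, congruentToPart_of_sub ![p₀, Z₁, Z₂] ?_⟩
  rintro _ ⟨⟨t, s⟩, ⟨ht, hsK⟩, rfl⟩
  obtain ⟨e1, e2, e3⟩ := hs t ht s
  set θ := κ * (α t 0 - p₀)
  set r := (α t 1 + s * β t 1 - Z₁) * Real.cos θ +
    1 * ((α t 2 + s * β t 2 - Z₂) * Real.sin θ) with hr
  have hcs := Real.sin_sq_add_cos_sq θ
  -- This is the gradient of the implicit equation, up to scale. Its square is `1 - (κ r)²`, so
  -- being spacelike it makes `arcsin (κ r)` an admissible parameter `v`.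
  have hpos := h.normal_pos ht hsK (n := ![-(κ * r), Real.sin θ, -Real.cos θ])
    (fun h0 => by
      have i1 := congrFun h0 1
      have i2 := congrFun h0 2
      simp at i1 i2
      rw [i1, i2] at hcs
      norm_num at hcs)
    (by simp [lor, h1 t ht]; linear_combination e3)
    (by simp [lor, h0 t ht]; linear_combination e1)
  have hlt : (κ * r) ^ 2 < 1 := by
    simp [lor] at hpos
    nlinarith
  have habs := abs_lt.1 ((sq_lt_one_iff_abs_lt_one _).1 hlt)
  refine ⟨(θ, Real.arcsin (κ * r)), ⟨Real.neg_pi_div_two_lt_arcsin.2 habs.1,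
    Real.arcsin_lt_pi_div_two.2 habs.2⟩, ?_⟩
  simp only [Real.sin_arcsin habs.1.le habs.2.le]
  apply vec_ext
  · simp [ruled, h0 t ht, θ]
    field_simp
  · simp [ruled]
    field_simp
    rw [hr]
    linear_combination (α t 1 + s * β t 1 - Z₁) * hcs - Real.sin θ * e2
  · simp [ruled]
    field_simp
    rw [hr]
    linear_combination (α t 2 + s * β t 2 - Z₂) * hcs + Real.cos θ * e2

/-- Passing to adapted coordinates through a linear map. -/
theorem adapted (h : MinimalRuled J K α α₁ α₂ β β₁ β₂) (hK : K.Nonempty) {T : L3 →ₗ[ℝ] L3}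
    (hT : Function.Injective T) (h0 : ∀ t ∈ J, T (β t) 0 = 0) {δ ω k ε : ℝ}
    (hg : ∀ x, T x 0 = 0 → T x 1 ^ 2 + δ * T x 2 ^ 2 = ε * lor x x)
    (hb : ∀ x y, T x 0 = 0 → T y 0 = 0 → T x 1 * T y 1 + δ * (T x 2 * T y 2) = ε * lor x y)
    (hF : ∀ x y, T y 0 = 0 →
      T x 1 * T y 1 + δ * (T x 2 * T y 2) - ω * (T x 0 * T y 2) = ε * lor x y)
    (hv : ∀ x y z, vol (T x) (T y) (T z) = k * vol x y z) :
    AdaptedRuled J δ ω (fun t => T (α t)) (fun t => T (α₁ t)) (fun t => T (α₂ t))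
      (fun t => T (β t)) (fun t => T (β₁ t)) (fun t => T (β₂ t)) := by
  have d1 := fun t ht => (h.deriv_β t ht).linearMap T
  have d2 := fun t ht => (h.deriv_β₁ t ht).linearMap T
  have h1 : ∀ t ∈ J, T (β₁ t) 0 = 0 := fun t ht =>
    eq_zero_of_hasDerivAt_of_eqOn_zero h.isOpen ht h0 (hasDerivAt_apply (d1 t ht) 0)
  have h2 : ∀ t ∈ J, T (β₂ t) 0 = 0 := fun t ht =>
    eq_zero_of_hasDerivAt_of_eqOn_zero h.isOpen ht h1 (hasDerivAt_apply (d2 t ht) 0)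
  refine ⟨h.isOpen, h.isPreconnected, h.an_α.linearMap T, h.an_α₁.linearMap T,
    h.an_β.linearMap T, h.an_β₁.linearMap T, fun t ht => (h.deriv_α t ht).linearMap T,
    fun t ht => (h.deriv_α₁ t ht).linearMap T, d1, d2, h0,
    fun t ht hc => h.dir_ne_zero hK ht (hT (hc.trans (map_zero T).symm)),
    fun t ht => ?_, fun t ht => ?_⟩
  · have e1 := hv (α₁ t) (β t) (β₂ t)
    have e2 := hv (α₂ t) (β t) (β₁ t)
    have e3 := hv (α₁ t) (β t) (β₁ t)
    simp only [vol, lor, cross_apply_zero, cross_apply_one, cross_apply_two, h0 t ht, h1 t ht,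
      h2 t ht] at e1 e2 e3
    have e4 := hg (β t) (h0 t ht)
    have e5 := hb (β t) (β₁ t) (h0 t ht) (h1 t ht)
    have e := h.eq_one t ht
    simp only [vol, lor, cross_apply_zero, cross_apply_one, cross_apply_two] at e
    simp only [lor] at e4 e5
    rw [e4, e5]
    linear_combination ε * k * e + ε *
      (-(β t 0 * β t 0) + β t 1 * β t 1 + β t 2 * β t 2) * (e1 - e2) -
      2 * ε * (-(β t 0 * β₁ t 0) + β t 1 * β₁ t 1 + β t 2 * β₁ t 2) * e3
  · have e1 := hv (α₁ t) (β t) (α₂ t)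
    have e3 := hv (α₁ t) (β t) (β₁ t)
    simp only [vol, lor, cross_apply_zero, cross_apply_one, cross_apply_two, h0 t ht, h1 t ht]
      at e1 e3
    have e4 := hg (β t) (h0 t ht)
    have e5 := hF (α₁ t) (β t) (h0 t ht)
    have e := h.eq_zero t ht
    simp only [vol, lor, cross_apply_zero, cross_apply_one, cross_apply_two] at e
    simp only [lor] at e4 e5
    rw [e4, e5]
    linear_combination ε * k * e + ε *
      (-(β t 0 * β t 0) + β t 1 * β t 1 + β t 2 * β t 2) * e1 -
      2 * ε * (-(α₁ t 0 * β t 0) + α₁ t 1 * β t 1 + α₁ t 2 * β t 2) * e3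

theorem isGeneric (h : MinimalRuled J K α α₁ α₂ β β₁ β₂) {T : L3 →ₗ[ℝ] L3}
    (h0 : ∀ t ∈ J, T (β t) 0 = 0) {δ k ε : ℝ}
    (hg : ∀ x, T x 0 = 0 → T x 1 ^ 2 + δ * T x 2 ^ 2 = ε * lor x x) (hε : ε ≠ 0) (hk : k ≠ 0)
    (hv : ∀ x y z, vol (T x) (T y) (T z) = k * vol x y z) {t₀ : ℝ} (ht₀ : t₀ ∈ J)
    (hgt : lor (β t₀) (β t₀) ≠ 0) (hD : vol (α₁ t₀) (β t₀) (β₁ t₀) ≠ 0) :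
    IsGeneric δ (fun t => T (α₁ t)) (fun t => T (β t)) (fun t => T (β₁ t)) t₀ := by
  have h1 : T (β₁ t₀) 0 = 0 := eq_zero_of_hasDerivAt_of_eqOn_zero h.isOpen ht₀ h0
    (hasDerivAt_apply ((h.deriv_β t₀ ht₀).linearMap T) 0)
  have e3 := hv (α₁ t₀) (β t₀) (β₁ t₀)
  have hne := mul_ne_zero hk hD
  rw [← e3] at hne
  simp only [vol, lor, cross_apply_zero, cross_apply_one, cross_apply_two, h0 t₀ ht₀, h1] at hne
  refine ⟨fun hc => hne ?_, fun hc => hne ?_, ?_⟩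
  · rw [hc]; ring
  · linear_combination T (α₁ t₀) 0 * hc
  · rw [hg _ (h0 t₀ ht₀)]
    exact mul_ne_zero hε hgt

theorem exists_coordinates (A : Matrix (Fin 3) (Fin 3) ℝ) : ∃ T : L3 →ₗ[ℝ] L3,
    (∀ x, T x 0 = A 0 0 * x 0 + A 0 1 * x 1 + A 0 2 * x 2) ∧
    (∀ x, T x 1 = A 1 0 * x 0 + A 1 1 * x 1 + A 1 2 * x 2) ∧
    ∀ x, T x 2 = A 2 0 * x 0 + A 2 1 * x 1 + A 2 2 * x 2 :=
  ⟨Matrix.toLin' A, by simp [Matrix.mulVec, dotProduct, Fin.sum_univ_three]⟩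

/-- Exchanging coordinates 0 and 1 puts the axis first; the form on directors becomes `x₁² - x₂²` up
to sign, whence `ε = -1`. As `sinh` is onto, the normal imposes no restriction. -/
theorem helicoid3_of_normalized (h : MinimalRuled J K α α₁ α₂ β β₁ β₂) (hK : K.Nonempty)
    (h0 : ∀ t ∈ J, β t 1 = 0) {t₀ : ℝ} (ht₀ : t₀ ∈ J) (hβ : β t₀ 2 = 0)
    (hg : lor (β t₀) (β t₀) ≠ 0) (hD : vol (α₁ t₀) (β t₀) (β₁ t₀) ≠ 0) :
    ∃ c, c ≠ 0 ∧ CongruentToPart (surfaceOn (ruled α β) (J ×ˢ K)) (helicoid3 c) := by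
  obtain ⟨T, T0, T1, T2⟩ := exists_coordinates !![0, 1, 0; 1, 0, 0; 0, 0, 1]
  simp at T0 T1 T2
  have hv : ∀ x y z, vol (T x) (T y) (T z) = -1 * vol x y z := fun x y z => by
    simp only [vol, lor, cross_apply_zero, cross_apply_one, cross_apply_two, T0, T1, T2]
    ring
  have h0' : ∀ t ∈ J, T (β t) 0 = 0 := fun t ht => by rw [T0, h0 t ht]
  have hgT : ∀ x, T x 0 = 0 → T x 1 ^ 2 + -1 * T x 2 ^ 2 = -1 * lor x x := fun x hx => by
    rw [T0] at hx
    rw [T1, T2, lor, hx]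
    ring
  have had := h.adapted hK (T := T) (δ := -1) (ω := 0) (k := -1) (ε := -1)
    (fun x y hxy => by
      have := fun i => congrFun hxy i
      exact vec_ext (by simpa [T1] using this 1) (by simpa [T0] using this 0)
        (by simpa [T2] using this 2))
    h0' hgT (fun x y hx hy => by rw [T0] at hx hy; rw [T1, T1, T2, T2, lor, hx, hy]; ring)
    (fun x y hy => by rw [T0] at hy; rw [T1, T1, T2, T2, lor, hy]; ring) hv
  have hgen := h.isGeneric h0' hgT (by norm_num) (by norm_num) hv ht₀ hg hD
  obtain ⟨κ, p₀, Z₁, Z₂, hκ, hs⟩ := had.exists_helicoid_eq ht₀ hgen (by simpa [T2] using hβ)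
    (fun x => Real.analyticAt_cosh) (fun x => Real.analyticAt_sinh)
    (fun x => (Real.hasDerivAt_cosh x).congr_deriv (by ring)) Real.hasDerivAt_sinh
    (fun x => by linarith [Real.cosh_sq x]) Real.sinh_zero
  refine ⟨κ, hκ, congruentToPart_of_sub ![Z₁, p₀, Z₂] ?_⟩
  rintro _ ⟨⟨t, s⟩, ⟨ht, hsK⟩, rfl⟩
  obtain ⟨e1, e2, e3⟩ := hs t ht s
  simp only [T0, T1, T2] at e1 e2 e3
  set θ := κ * (α t 1 - p₀)
  set r := (α t 0 + s * β t 0 - Z₁) * Real.cosh θ +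
    -1 * ((α t 2 + s * β t 2 - Z₂) * Real.sinh θ) with hr
  have hcs := Real.cosh_sq θ
  refine ⟨(Real.arsinh (κ * r), θ), mem_univ _, ?_⟩
  simp only [Real.sinh_arsinh]
  apply vec_ext
  · simp [ruled]
    field_simp
    rw [hr]
    linear_combination (α t 0 + s * β t 0 - Z₁) * hcs + Real.sinh θ * e2
  · simp [ruled, h0 t ht, θ]
    field_simp
  · simp [ruled]
    field_simp
    rw [hr]
    linear_combination (α t 2 + s * β t 2 - Z₂) * hcs + Real.cosh θ * e2

theorem helicoid2_of_normalized (h : MinimalRuled J K α α₁ α₂ β β₁ β₂) (hKn : K.Nonempty)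
    (hKc : K.OrdConnected)
    (h0 : ∀ t ∈ J, β t 2 = 0) {t₀ : ℝ} (ht₀ : t₀ ∈ J) (hβ : β t₀ 0 = 0)
    (hg : lor (β t₀) (β t₀) ≠ 0) (hD : vol (α₁ t₀) (β t₀) (β₁ t₀) ≠ 0) :
    ∃ c, c ≠ 0 ∧ CongruentToPart (surfaceOn (ruled α β) (J ×ˢ K)) (helicoid2 c) := by
  have h1 : ∀ t ∈ J, β₁ t 2 = 0 := fun t ht =>
    eq_zero_of_hasDerivAt_of_eqOn_zero h.isOpen ht h0 (hasDerivAt_apply (h.deriv_β t ht) 2)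
  obtain ⟨T, T0, T1, T2⟩ := exists_coordinates !![0, 0, 1; 0, 1, 0; 1, 0, 0]
  simp at T0 T1 T2
  have hv : ∀ x y z, vol (T x) (T y) (T z) = -1 * vol x y z := fun x y z => by
    simp only [vol, lor, cross_apply_zero, cross_apply_one, cross_apply_two, T0, T1, T2]
    ring
  have h0' : ∀ t ∈ J, T (β t) 0 = 0 := fun t ht => by rw [T0, h0 t ht]
  have hgT : ∀ x, T x 0 = 0 → T x 1 ^ 2 + -1 * T x 2 ^ 2 = 1 * lor x x := fun x hx => by
    rw [T0] at hx
    rw [T1, T2, lor, hx]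
    ring
  have had := h.adapted hKn (T := T) (δ := -1) (ω := 0) (k := -1) (ε := 1)
    (fun x y hxy => by
      have := fun i => congrFun hxy i
      exact vec_ext (by simpa [T2] using this 2) (by simpa [T1] using this 1)
        (by simpa [T0] using this 0))
    h0' hgT (fun x y hx hy => by rw [T0] at hx hy; rw [T1, T1, T2, T2, lor, hx, hy]; ring)
    (fun x y hy => by rw [T0] at hy; rw [T1, T1, T2, T2, lor, hy]; ring) hv
  have hgen := h.isGeneric h0' hgT (by norm_num) (by norm_num) hv ht₀ hg hD
  obtain ⟨κ, p₀, Z₁, Z₂, hκ, hs⟩ := had.exists_helicoid_eq ht₀ hgen (by simpa [T2] using hβ)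
    (fun x => Real.analyticAt_cosh) (fun x => Real.analyticAt_sinh)
    (fun x => (Real.hasDerivAt_cosh x).congr_deriv (by ring)) Real.hasDerivAt_sinh
    (fun x => by linarith [Real.cosh_sq x]) Real.sinh_zero
  simp only [T0, T1, T2] at hs
  set R : ℝ × ℝ → ℝ := fun p => κ * ((α p.1 1 + p.2 * β p.1 1 - Z₁) *
      Real.cosh (κ * (α p.1 2 - p₀)) +
    -1 * ((α p.1 0 + p.2 * β p.1 0 - Z₂) * Real.sinh (κ * (α p.1 2 - p₀)))) with hR
  -- The normal `(cosh θ, sinh θ, R)` has square `R² - 1`.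
  have hRsq : ∀ p ∈ J ×ˢ K, 1 < R p ^ 2 := by
    rintro ⟨t, s⟩ ⟨ht, hsK⟩
    obtain ⟨e1, e2, e3⟩ := hs t ht s
    have hcs := Real.cosh_sq (κ * (α t 2 - p₀))
    have hpos := h.normal_pos ht hsK
      (n := ![Real.cosh (κ * (α t 2 - p₀)), Real.sinh (κ * (α t 2 - p₀)), R (t, s)])
      (fun h0 => (Real.cosh_pos _).ne' (congrFun h0 0))
      (by simp [lor, h1 t ht, hR]; linear_combination e3)
      (by simp [lor, h0 t ht]; linear_combination e1)
    simp [lor] at hpos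
    nlinarith
  have hRc : ContinuousOn R (J ×ˢ K) := by
    have ca : ∀ i, ContinuousOn (fun p : ℝ × ℝ => α p.1 i) (J ×ˢ K) := fun i =>
      (h.an_α.comp_apply i).continuousOn.comp continuousOn_fst fun p hp => hp.1
    have cb : ∀ i, ContinuousOn (fun p : ℝ × ℝ => β p.1 i) (J ×ˢ K) := fun i =>
      (h.an_β.comp_apply i).continuousOn.comp continuousOn_fst fun p hp => hp.1
    have c0 := ca 0
    have c1 := ca 1
    have c2 := ca 2
    have b0 := cb 0
    have b1 := cb 1
    have cθ : ContinuousOn (fun p : ℝ × ℝ => κ * (α p.1 2 - p₀)) (J ×ˢ K) :=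
      continuousOn_const.mul (c2.sub continuousOn_const)
    exact continuousOn_const.mul ((((c1.add (continuousOn_snd.mul b1)).sub continuousOn_const).mul
      (Real.continuous_cosh.comp_continuousOn cθ)).add (continuousOn_const.mul
      (((c0.add (continuousOn_snd.mul b0)).sub continuousOn_const).mul
      (Real.continuous_sinh.comp_continuousOn cθ))))
  -- The parameter domain is connected and `R` never takes the value `0`, so a single congruence
  -- serves the whole surface.
  have hsign : (∀ p ∈ J ×ˢ K, 1 < R p) ∨ ∀ p ∈ J ×ˢ K, R p < -1 := by
    by_contra! hc
    obtain ⟨⟨p, hp, hp'⟩, q, hq, hq'⟩ := hc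
    have hp2 := hRsq p hp
    have hq2 := hRsq q hq
    obtain ⟨x, hx, hx0⟩ := (h.isPreconnected.prod hKc.isPreconnected).intermediate_value hp hq hRc
      (show (0 : ℝ) ∈ Icc (R p) (R q) from ⟨by nlinarith, by nlinarith⟩)
    have := hRsq x hx
    rw [hx0] at this
    norm_num at this
  have hpt : ∀ t ∈ J, ∀ s, κ * (α t 0 + s * β t 0 - Z₂) =
      R (t, s) * Real.sinh (κ * (α t 2 - p₀)) ∧
      κ * (α t 1 + s * β t 1 - Z₁) = R (t, s) * Real.cosh (κ * (α t 2 - p₀)) := fun t ht s => by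
    obtain ⟨e1, e2, e3⟩ := hs t ht s
    have hcs := Real.cosh_sq (κ * (α t 2 - p₀))
    simp only [hR]
    constructor
    · linear_combination κ * (α t 0 + s * β t 0 - Z₂) * (-1) * hcs -
        κ * Real.cosh (κ * (α t 2 - p₀)) * e2
    · linear_combination κ * (α t 1 + s * β t 1 - Z₁) * (-1) * hcs -
        κ * Real.sinh (κ * (α t 2 - p₀)) * e2
  rcases hsign with hsign | hsign
  · refine ⟨κ, hκ, congruentToPart_of_sub ![Z₂, Z₁, p₀] ?_⟩
    rintro _ ⟨⟨t, s⟩, hts, rfl⟩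
    obtain ⟨e1, e2⟩ := hpt t hts.1 s
    refine ⟨(κ * (α t 2 - p₀), Real.arcosh (R (t, s))), Real.arcosh_pos (hsign _ hts), ?_⟩
    simp only [Real.cosh_arcosh (hsign _ hts).le]
    apply vec_ext
    · simp [ruled]
      field_simp
      exact e1.symm
    · simp [ruled]
      field_simp
      exact e2.symm
    · simp [ruled, h0 t hts.1]
      field_simp
  -- Negating the first two coordinates replaces `R` by `-R` and keeps the height, which reduces to
  -- the previous branch.
  · obtain ⟨Λ, L0, L1, L2⟩ := exists_coordinates !![-1, 0, 0; 0, -1, 0; 0, 0, 1]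
    simp at L0 L1 L2
    refine ⟨κ, hκ, fun x => Λ x + ![Z₂, Z₁, -p₀], ⟨Λ, _, fun x y => ?_, fun x => rfl⟩, ?_⟩
    · simp only [lor, L0, L1, L2]
      ring
    rintro _ ⟨_, ⟨⟨t, s⟩, hts, rfl⟩, rfl⟩
    obtain ⟨e1, e2⟩ := hpt t hts.1 s
    have hlt : 1 < -R (t, s) := by linarith [hsign _ hts]
    refine ⟨(κ * (α t 2 - p₀), Real.arcosh (-R (t, s))), Real.arcosh_pos hlt, ?_⟩
    simp only [Real.cosh_arcosh hlt.le]
    apply vec_ext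
    · simp [ruled, L0]
      field_simp
      linear_combination e1
    · simp [ruled, L1]
      field_simp
      linear_combination e2
    · simp [ruled, h0 t hts.1, L2]
      field_simp
      ring

theorem conjEnneper2_of_normalized (h : MinimalRuled J K α α₁ α₂ β β₁ β₂) (hK : K.Nonempty)
    (h0 : ∀ t ∈ J, β t 0 + β t 2 = 0) {t₀ : ℝ} (ht₀ : t₀ ∈ J)
    (hg : lor (β t₀) (β t₀) ≠ 0) (hD : vol (α₁ t₀) (β t₀) (β₁ t₀) ≠ 0) :
    ∃ c, c ≠ 0 ∧ CongruentToPart (surfaceOn (ruled α β) (J ×ˢ K)) (conjEnneper2 c) := by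
  -- Null coordinates `x₀ + x₂` and `x₀ - x₂`: the form degenerates on the directors, so `δ = 0`,
  -- and `ω = 1/2` records the mixed term.
  obtain ⟨T, T0, T1, T2⟩ := exists_coordinates !![1, 0, 1; 0, 1, 0; 1, 0, -1]
  simp at T0 T1 T2
  have hv : ∀ x y z, vol (T x) (T y) (T z) = -2 * vol x y z := fun x y z => by
    simp only [vol, lor, cross_apply_zero, cross_apply_one, cross_apply_two, T0, T1, T2]
    ring
  have h0' : ∀ t ∈ J, T (β t) 0 = 0 := fun t ht => by rw [T0, h0 t ht]
  have hgT : ∀ x, T x 0 = 0 → T x 1 ^ 2 + 0 * T x 2 ^ 2 = 1 * lor x x := fun x hx => by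
    rw [T0] at hx
    rw [T1, lor]
    linear_combination (x 0 - x 2) * hx
  have had := h.adapted hK (T := T) (δ := 0) (ω := 1 / 2) (k := -2) (ε := 1)
    (fun x y hxy => by
      have i0 := congrFun hxy 0
      have i1 := congrFun hxy 1
      have i2 := congrFun hxy 2
      rw [T0, T0] at i0
      rw [T1, T1] at i1
      rw [T2, T2] at i2
      exact vec_ext (by linarith) i1 (by linarith))
    h0' hgT
    (fun x y hx hy => by
      rw [T0] at hx hy; rw [T1, T1, lor]; linear_combination y 0 * hx - x 2 * hy)
    (fun x y hy => by
      rw [T0] at hy; rw [T1, T1, T2, T2, T0, lor]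
      linear_combination (x 0 - x 2) / 2 * hy) hv
  have hgen := h.isGeneric h0' hgT (by norm_num) (by norm_num) hv ht₀ hg hD
  obtain ⟨κ, p₀, Z₁, Z₂, hκ, hs⟩ := had.exists_enneper_eq ht₀ hgen
  simp only [T0, T1, T2] at hs
  -- With `c = -κ/2` the model has `x₀ + x₂ = 2u/κ` and `x₁ = (u² + v² - 1)/κ`. This forces `u = κ
  -- Q/2` and `v² = κ Y - κ² Q²/4`, and accounts for the shift by `1/κ`.
  refine ⟨-κ / 2, by simpa using hκ,
    congruentToPart_of_sub ![(p₀ + Z₂) / 2, Z₁ + 1 / κ, (p₀ - Z₂) / 2] ?_⟩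
  rintro _ ⟨⟨t, s⟩, ⟨ht, hsK⟩, rfl⟩
  obtain ⟨e1, e2, e3⟩ := hs t ht s
  have h1t : β₁ t 0 + β₁ t 2 = 0 := eq_zero_of_hasDerivAt_of_eqOn_zero h.isOpen ht h0
    ((hasDerivAt_apply (h.deriv_β t ht) 0).add (hasDerivAt_apply (h.deriv_β t ht) 2))
  have h0t := h0 t ht
  set Q := α t 0 + α t 2 - p₀ with hQ
  set Y := α t 1 + s * β t 1 - Z₁ with hY
  set G := κ * Y - κ ^ 2 * Q ^ 2 / 2 with hG
  -- The square of this normal is `4 G + κ² Q²`, four times the required value of `v²`.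
  have hpos := h.normal_pos ht hsK (n := ![G - 1, -(κ * Q), -1 - G])
    (fun h0 => by
      have i0 := congrFun h0 0
      have i2 := congrFun h0 2
      simp at i0 i2
      linarith)
    (by simp [lor]; linear_combination e3 - s * G * h1t)
    (by simp [lor]; linear_combination e1 - G * h0t)
  have hw : 0 < κ * Y - κ ^ 2 * Q ^ 2 / 4 := by
    simp [lor] at hpos
    nlinarith
  refine ⟨(κ * Q / 2, √(κ * Y - κ ^ 2 * Q ^ 2 / 4)), Real.sqrt_pos.2 hw, ?_⟩
  simp only [Real.sq_sqrt hw.le]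
  have hP : α t 0 + s * β t 0 + (α t 2 + s * β t 2) = Q + p₀ := by
    rw [hQ]; linear_combination s * h0t
  clear_value Q Y G
  apply vec_ext
  · simp [ruled]
    field_simp
    linear_combination (-48) * e2 - 48 * hP
  · simp [ruled]
    field_simp
    linear_combination 48 * κ * hY
  · simp [ruled]
    field_simp
    linear_combination 48 * e2 - 48 * hP

/-! ### Cylinders -/

/-- A cylinder over a null direction is part of a flat `B`-scroll or planar. -/
theorem scroll_of_normalized (h : MinimalRuled J K α α₁ α₂ β β₁ β₂) (hJ : J.Nonempty)
    (hK : K.Nonempty) (h0 : ∀ t ∈ J, β t 2 = -β t 0) (h1 : ∀ t ∈ J, β t 1 = 0) :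
    (∃ P, IsLorentzianPlane P ∧ CongruentToPart (surfaceOn (ruled α β) (J ×ˢ K)) P) ∨
    (∃ S, IsFlatBScroll S ∧ CongruentToPart (surfaceOn (ruled α β) (J ×ˢ K)) S) := by
  -- `q` is the product of `α` with the ruling direction `(1, 0, -1)`. Timelikeness forces `q' ≠ 0`,
  -- so `q` serves as the new parameter, with `Y` the remaining coordinate.
  set q : ℝ → ℝ := fun t => -(α t 0 + α t 2) with hq
  have hqa : AnalyticOnNhd ℝ q J := ((h.an_α.comp_apply 0).add (h.an_α.comp_apply 2)).neg
  have hqd : ∀ t ∈ J, HasDerivAt q (-(α₁ t 0 + α₁ t 2)) t := fun t ht =>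
    ((hasDerivAt_apply (h.deriv_α t ht) 0).add (hasDerivAt_apply (h.deriv_α t ht) 2)).neg
  have hq0 : ∀ t ∈ J, -(α₁ t 0 + α₁ t 2) ≠ 0 := fun t ht hc => by
    obtain ⟨s, hs⟩ := hK
    have hg := h.timelike t ht s hs
    have e0 : β₁ t 2 + β₁ t 0 = 0 := eq_zero_of_hasDerivAt_of_eqOn_zero h.isOpen ht
      (f := fun t => β t 2 + β t 0) (fun r hr => by rw [h0 r hr]; ring)
      ((hasDerivAt_apply (h.deriv_β t ht) 2).add (hasDerivAt_apply (h.deriv_β t ht) 0))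
    have hgg : gram (α₁ t + s • β₁ t) (β t) = -(β t 0 * -(α₁ t 0 + α₁ t 2)) ^ 2 := by
      have e1 : β₁ t 2 = -β₁ t 0 := by linarith
      simp only [gram, lor, Pi.add_apply, Pi.smul_apply, smul_eq_mul, h0 t ht, h1 t ht, e1]
      ring
    rw [hgg, hc] at hg
    simp at hg
  have hinj : InjOn q J := by
    have hlt : ∀ a ∈ J, ∀ b ∈ J, a < b → q a ≠ q b := fun a ha b hb hab hqab => by
      have hsub : Icc a b ⊆ J := h.ordConnected.out ha hb
      obtain ⟨x, hx, hx'⟩ := exists_hasDerivAt_eq_zero hab (hqa.continuousOn.mono hsub) hqab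
        fun x hx => hqd x (hsub (Ioo_subset_Icc_self hx))
      exact hq0 x (hsub (Ioo_subset_Icc_self hx)) hx'
    intro a ha b hb hab
    rcases lt_trichotomy a b with hl | he | hl
    · exact absurd hab (hlt a ha b hb hl)
    · exact he
    · exact absurd hab.symm (hlt b hb a ha hl)
  set I : Set ℝ := q '' J with hI
  have hIo : IsOpen I := isOpen_iff_mem_nhds.2 <| by
    rintro _ ⟨t, ht, rfl⟩
    have hs : HasStrictDerivAt q (-(α₁ t 0 + α₁ t 2)) t := by
      have := (hqa t ht).hasStrictDerivAt
      rwa [(hqd t ht).deriv] at this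
    rw [← hs.map_nhds_eq (hq0 t ht)]
    exact image_mem_map (h.isOpen.mem_nhds ht)
  have hIc : I.OrdConnected := (h.isPreconnected.image q hqa.continuousOn).ordConnected
  set Y : ℝ → ℝ := fun τ => α (Function.invFunOn q J τ) 1 with hY
  have hYq : ∀ t ∈ J, Y (q t) = α t 1 := fun t ht => by
    simp only [hY, hinj.leftInvOn_invFunOn ht]
  have hYa : AnalyticOnNhd ℝ Y I := by
    rintro _ ⟨t, ht, rfl⟩
    refine (analyticAt_comp_iff_of_deriv_ne_zero (hqa t ht)
      (by rw [(hqd t ht).deriv]; exact hq0 t ht)).1 ((h.an_α.comp_apply 1 t ht).congr ?_)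
    exact (h.isOpen.eventually_mem ht).mono fun r hr => (hYq r hr).symm
  have hY'a : AnalyticOnNhd ℝ (deriv Y) I := fun τ hτ => (hYa τ hτ).deriv
  have hY''a : AnalyticOnNhd ℝ (deriv (deriv Y)) I := fun τ hτ => (hY'a τ hτ).deriv
  have hYd : ∀ τ ∈ I, HasDerivAt Y (deriv Y τ) τ := fun τ hτ =>
    (hYa τ hτ).differentiableAt.hasDerivAt
  have hY'd : ∀ τ ∈ I, HasDerivAt (deriv Y) (deriv (deriv Y) τ) τ := fun τ hτ =>
    (hY'a τ hτ).differentiableAt.hasDerivAt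
  -- If `Y'` is a constant `k`, then `x₁ - k τ` is constant on the surface and `(-k, 1, k)` is a
  -- normal. Otherwise `Y''` is the function `c` of a scroll.
  by_cases hc : ∀ τ ∈ I, deriv (deriv Y) τ = 0
  · left
    obtain ⟨k, hk⟩ := hIo.exists_is_const_of_deriv_eq_zero hIc.isPreconnected
      (fun τ hτ => (hY'd τ hτ).differentiableAt.differentiableWithinAt) hc
    refine h.planar hJ hK (m := ![-k, 1, k]) (fun h0 => by simpa using congrFun h0 1)
      (fun t ht => ?_) fun t ht => by simp [lor, h0 t ht, h1 t ht]
    have d1 := ((hYd (q t) (mem_image_of_mem q ht)).comp t (hqd t ht)).unique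
      ((hasDerivAt_apply (h.deriv_α t ht) 1).congr_of_eventuallyEq
        ((h.isOpen.eventually_mem ht).mono hYq))
    rw [hk _ (mem_image_of_mem q ht)] at d1
    simp [lor]
    linear_combination -d1
  · right
    push Not at hc
    -- `N` is the coordinate `x₀ - x₂` of the new base curve; `N' = -Y'²` is the condition that the
    -- curve be null.
    obtain ⟨N, hNa, hNd⟩ := exists_primitive hIo hIc (hY'a.pow 2).neg
    refine ⟨_, ⟨I, fun τ => ![(-τ + N τ) / 2, Y τ, (-τ - N τ) / 2],
      fun τ => ![(-1 - deriv Y τ ^ 2) / 2, deriv Y τ, (-1 + deriv Y τ ^ 2) / 2],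
      fun _ => ![1, 0, -1], fun τ => ![-deriv Y τ, 1, deriv Y τ], 0, deriv (deriv Y),
      hIo, hIc, ?_, hY''a, hc, ?_, fun τ hτ => hasDerivAt_const _ _, ?_, rfl⟩,
      congruentToPart_of_subset ?_⟩
    · exact analyticOnNhd_vec
        ((analyticOnNhd_id.neg.add hNa).div analyticOnNhd_const fun _ _ => two_ne_zero) hYa
        ((analyticOnNhd_id.neg.sub hNa).div analyticOnNhd_const fun _ _ => two_ne_zero)
    · have hC : ∀ τ ∈ I, HasDerivAt (fun τ => (![-deriv Y τ, 1, deriv Y τ] : L3))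
          (-((0 : ℝ) • ![(-1 - deriv Y τ ^ 2) / 2, deriv Y τ, (-1 + deriv Y τ ^ 2) / 2]) -
            deriv (deriv Y) τ • ![1, 0, -1]) τ := fun τ hτ =>
        hasDerivAt_vec (by simpa using! (hY'd τ hτ).neg) (by simpa using! hasDerivAt_const τ (1 : ℝ))
          (by simpa using! hY'd τ hτ)
      refine ⟨fun τ _ => ?_, fun τ _ => ?_, fun τ _ => ?_, fun τ _ => ?_, fun τ _ => ?_,
        fun τ _ => ?_, fun τ hτ => ?_, hC⟩
      · simp [lor]; ring
      · simp [lor]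
      · simp [lor]; ring
      · simp [lor]; ring
      · simp [lor]
      · simp [lor]
      · refine hasDerivAt_vec ?_ (hYd τ hτ) ?_
        · exact (((hasDerivAt_id τ).neg.add (hNd τ hτ)).div_const 2).congr_deriv (by simp; ring)
        · exact (((hasDerivAt_id τ).neg.sub (hNd τ hτ)).div_const 2).congr_deriv (by simp)
    · intro τ hτ
      exact hasDerivAt_vec (by simpa using! (hY'd τ hτ).neg)
        (by simpa using! hasDerivAt_const τ (1 : ℝ)) (by simpa using! hY'd τ hτ)
    · rintro _ ⟨⟨t, s⟩, ⟨ht, -⟩, rfl⟩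
      refine ⟨(q t, α t 0 + s * β t 0 - (-q t + N (q t)) / 2), ⟨mem_image_of_mem q ht, mem_univ _⟩,
        ?_⟩
      apply vec_ext
      · simp [ruled]
      · simp [ruled, hYq t ht, h1 t ht]
      · simp [ruled, h0 t ht, hq]
        ring

theorem eq_smul_of_parallel (h : MinimalRuled J K α α₁ α₂ β β₁ β₂) (hK : K.Nonempty)
    (hc : ∀ t ∈ J, cross (β t) (β₁ t) = 0) {t₀ : ℝ} (ht₀ : t₀ ∈ J) {t : ℝ} (ht : t ∈ J) :
    ∃ f : ℝ, β t = f • β t₀ :=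
  eq_smul_of_cross_eq_zero (h.dir_ne_zero hK ht₀) (cross_eq_zero_of_parallel h.isOpen
    h.isPreconnected h.an_β h.deriv_β hc ht₀ (h.dir_ne_zero hK ht₀) t ht)

/-- Cylinders are planar or part of a flat `B`-scroll. -/
theorem cylinder (h : MinimalRuled J K α α₁ α₂ β β₁ β₂) (hJ : J.Nonempty) (hK : K.Nonempty)
    (hc : ∀ t ∈ J, cross (β t) (β₁ t) = 0) :
    (∃ P, IsLorentzianPlane P ∧ CongruentToPart (surfaceOn (ruled α β) (J ×ˢ K)) P) ∨
    (∃ S, IsFlatBScroll S ∧ CongruentToPart (surfaceOn (ruled α β) (J ×ˢ K)) S) := by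
  obtain ⟨t₀, ht₀⟩ := hJ
  have he := h.dir_ne_zero hK ht₀
  by_cases hee : lor (β t₀) (β t₀) = 0
  · obtain ⟨Λ, hΛ, k, hk, hΛe⟩ := exists_isLorentz_of_null he hee
    have hdir : ∀ t ∈ J, ∃ f : ℝ, Λ (β t) = f • ![1, 0, -1] := fun t ht => by
      obtain ⟨f, hf⟩ := h.eq_smul_of_parallel hK hc ht₀ ht
      exact ⟨f * k, by rw [hf, map_smul, hΛe, smul_smul]⟩
    refine ((h.map hΛ).scroll_of_normalized ⟨t₀, ht₀⟩ hK (fun t ht => ?_) fun t ht => ?_).imp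
      (fun ⟨P, hP, hM⟩ => ⟨P, hP, congruentToPart_of_map hΛ hM⟩)
      fun ⟨P, hP, hM⟩ => ⟨P, hP, congruentToPart_of_map hΛ hM⟩
    · obtain ⟨f, hf⟩ := hdir t ht
      simp [hf]
    · obtain ⟨f, hf⟩ := hdir t ht
      simp [hf]
  · left
    have hv0 : ∀ t ∈ J, cross (β t₀) (α₁ t) ≠ 0 := fun t ht h0 => by
      obtain ⟨s, hs⟩ := hK
      obtain ⟨k, hk⟩ := eq_smul_of_cross_eq_zero he h0
      obtain ⟨f, hf⟩ := h.eq_smul_of_parallel ⟨s, hs⟩ hc ht₀ ht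
      obtain ⟨l, hl⟩ := eq_smul_of_cross_eq_zero (h.dir_ne_zero ⟨s, hs⟩ ht) (hc t ht)
      refine (h.timelike t ht s hs).ne ?_
      rw [hk, hl, hf, smul_smul, smul_smul, ← add_smul]
      simp only [gram, lor_smul_left, lor_smul_right]
      ring
    -- Since `β'` is parallel to `β`, `eq_zero` reduces to `det(β t₀, α', α'') = 0`. Hence the
    -- normal `β t₀ × α'` is parallel to its derivative.
    have hpar := cross_eq_zero_of_parallel h.isOpen h.isPreconnected
      (v := fun t => cross (β t₀) (α₁ t)) (v' := fun t => cross (β t₀) (α₂ t))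
      ((analyticOnNhd_const (v := β t₀)).cross h.an_α₁)
      (fun t ht => by
        refine ((hasDerivAt_const t (β t₀)).cross (h.deriv_α₁ t ht)).congr_deriv ?_
        apply vec_ext <;> simp [cross])
      (fun t ht => by
        obtain ⟨f, hf⟩ := h.eq_smul_of_parallel hK hc ht₀ ht
        obtain ⟨l, hl⟩ := eq_smul_of_cross_eq_zero (h.dir_ne_zero hK ht) (hc t ht)
        have hf0 : f ≠ 0 := fun h0 => h.dir_ne_zero hK ht (by rw [hf, h0, zero_smul])
        have h1 := h.eq_zero t ht
        have h2 : vol (α₁ t) (β t) (β₁ t) = 0 := by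
          rw [hl, vol, lor_smul_right, lor_cross_right, mul_zero]
        have h3 : vol (α₁ t) (β t) (α₂ t) = -f * vol (β t₀) (α₁ t) (α₂ t) := by
          rw [hf]
          simp only [vol, lor, cross_apply_zero, cross_apply_one, cross_apply_two, Pi.smul_apply,
            smul_eq_mul]
          ring
        rw [h2, h3, hf, lor_smul_left, lor_smul_right] at h1
        have h4 : vol (β t₀) (α₁ t) (α₂ t) = 0 := by
          have : f ^ 3 * lor (β t₀) (β t₀) * vol (β t₀) (α₁ t) (α₂ t) = 0 := by
            linear_combination -h1
          exact (mul_eq_zero.1 this).resolve_left (mul_ne_zero (pow_ne_zero 3 hf0) hee)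
        rw [cross_cross_cross, h4, neg_zero, zero_smul])
      ht₀ (hv0 t₀ ht₀)
    refine h.planar ⟨t₀, ht₀⟩ hK (hv0 t₀ ht₀) (fun t ht => ?_) fun t ht => ?_
    · exact lor_eq_zero_of_parallel (hv0 t ht) (hpar t ht) (lor_cross_right _ _)
    · obtain ⟨f, hf⟩ := h.eq_smul_of_parallel hK hc ht₀ ht
      rw [hf, lor_smul_right, lor_cross_left, mul_zero]

end MinimalRuled

/-! ### Causal character of vectors -/

/-- Totally isotropic subspaces of `𝕃³` have dimension at most one. -/
theorem cross_eq_zero_of_null {u v : L3} (hu : u ≠ 0) (huu : lor u u = 0) (huv : lor u v = 0)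
    (hvv : lor v v = 0) : cross u v = 0 := by
  simp only [lor] at huu huv hvv
  have h0 : u 0 ≠ 0 := fun h0 => by
    rw [h0] at huu
    exact hu (vec_ext h0 (by simp only [Pi.zero_apply]; nlinarith)
      (by simp only [Pi.zero_apply]; nlinarith))
  have h1 : u 2 * v 1 - u 1 * v 2 = 0 := by
    have : (u 2 * v 1 - u 1 * v 2) ^ 2 = 0 := by
      linear_combination (v 1 ^ 2 + v 2 ^ 2) * huu - (u 0 * v 0 + u 1 * v 1 + u 2 * v 2) * huv
        + u 0 ^ 2 * hvv
    exact pow_eq_zero_iff two_ne_zero |>.1 this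
  apply vec_ext
  · exact h1
  · refine mul_left_cancel₀ h0 ?_
    simp only [cross_apply_one, Pi.zero_apply]
    linear_combination v 2 * huu - u 2 * huv + u 1 * h1
  · refine mul_left_cancel₀ h0 ?_
    simp only [cross_apply_two, Pi.zero_apply]
    linear_combination (-v 1) * huu + u 1 * huv + u 2 * h1

theorem exists_normalize {x : L3} (hx : lor x x ≠ 0) :
    ∃ k : ℝ, k ≠ 0 ∧ lor (k • x) (k • x) = SignType.sign (lor x x) := by
  have habs : 0 < |lor x x| := abs_pos.2 hx
  refine ⟨(√|lor x x|)⁻¹, inv_ne_zero (Real.sqrt_pos.2 habs).ne', ?_⟩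
  rw [lor_smul_left, lor_smul_right, ← mul_assoc, ← mul_inv, Real.mul_self_sqrt habs.le]
  rcases hx.lt_or_gt with h | h
  · simp [sign_neg h, abs_of_neg h, inv_mul_cancel₀ hx]
  · simp [sign_pos h, abs_of_pos h, inv_mul_cancel₀ hx]

/-- Orthogonality turns Cauchy–Schwarz for the spatial parts into a bound on `(m 0 * x 0)²` that two
timelike vectors would violate. -/
theorem lor_pos_of_timelike {m x : L3} (hm : lor m m < 0) (hmx : lor m x = 0)
    (hx : lor x x ≠ 0) : 0 < lor x x := by
  by_contra! hc
  have hx' := lt_of_le_of_ne hc hx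
  simp only [lor] at *
  have h2 : (m 0 * x 0) ^ 2 ≤ (m 1 ^ 2 + m 2 ^ 2) * (x 1 ^ 2 + x 2 ^ 2) := by
    have : m 0 * x 0 = m 1 * x 1 + m 2 * x 2 := by linarith
    rw [this]
    nlinarith [sq_nonneg (m 1 * x 2 - m 2 * x 1)]
  have h3 : (m 1 ^ 2 + m 2 ^ 2) * (x 1 ^ 2 + x 2 ^ 2) < m 0 ^ 2 * x 0 ^ 2 :=
    mul_lt_mul'' (by linarith) (by linarith) (by positivity) (by positivity)
  nlinarith

/-! ### Surfaces that are not cylinders -/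

namespace MinimalRuled

variable {J K : Set ℝ} {α α₁ α₂ β β₁ β₂ : ℝ → L3}

/-- For null `β` timelikeness forces `⟨α', β⟩ ≠ 0`, so `eq_zero` gives `det(α', β, β') = 0`. The
Gram determinant then makes `β'` null; being orthogonal to `β`, it is parallel to `β`. -/
theorem dir_not_null (h : MinimalRuled J K α α₁ α₂ β β₁ β₂) (hK : K.Nonempty) {t₁ : ℝ}
    (ht₁ : t₁ ∈ J) (hn : cross (β t₁) (β₁ t₁) ≠ 0) : ¬∀ t ∈ J, lor (β t) (β t) = 0 := by
  intro hg
  have hg1 : lor (β t₁) (β₁ t₁) = 0 := by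
    have := eq_zero_of_hasDerivAt_of_eqOn_zero h.isOpen ht₁ hg
      ((h.deriv_β t₁ ht₁).lor (h.deriv_β t₁ ht₁))
    rw [lor_comm (β₁ t₁)] at this
    linarith
  obtain ⟨s, hs⟩ := hK
  have hF : lor (α₁ t₁) (β t₁) ≠ 0 := fun hF => by
    have := h.timelike t₁ ht₁ s hs
    simp [gram, hg t₁ ht₁, lor_add_left, lor_smul_left, hF, lor_comm (β₁ t₁), hg1] at this
  have hD : vol (α₁ t₁) (β t₁) (β₁ t₁) = 0 := by
    have := h.eq_zero t₁ ht₁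
    rw [hg t₁ ht₁, zero_mul] at this
    simpa [hF] using this.symm
  have h2 := vol_sq (α₁ t₁) (β t₁) (β₁ t₁)
  rw [hD, hg t₁ ht₁, hg1] at h2
  have h3 : lor (α₁ t₁) (β t₁) ^ 2 * lor (β₁ t₁) (β₁ t₁) = 0 := by linear_combination -h2
  exact hn (cross_eq_zero_of_null (h.dir_ne_zero ⟨s, hs⟩ ht₁) (hg t₁ ht₁) hg1
    ((mul_eq_zero.1 h3).resolve_left (pow_ne_zero 2 hF)))

/-- The directors of a minimal timelike ruled surface which is not a cylinder are orthogonal to a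
fixed vector; the surface is planar unless it has a generic point. -/
theorem exists_normal (h : MinimalRuled J K α α₁ α₂ β β₁ β₂) (hK : K.Nonempty) {t₁ : ℝ}
    (ht₁ : t₁ ∈ J) (hn : cross (β t₁) (β₁ t₁) ≠ 0) :
    ∃ m : L3, m ≠ 0 ∧ (∀ t ∈ J, lor m (β t) = 0) ∧ ((∀ t ∈ J, lor m (α₁ t) = 0) ∨
      ∃ t ∈ J, lor (β t) (β t) ≠ 0 ∧ vol (α₁ t) (β t) (β₁ t) ≠ 0) := by
  have hg := h.dir_not_null hK ht₁ hn
  have avol : ∀ {u v w : ℝ → L3}, AnalyticOnNhd ℝ u J → AnalyticOnNhd ℝ v J →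
      AnalyticOnNhd ℝ w J → AnalyticOnNhd ℝ (fun t => vol (u t) (v t) (w t)) J :=
    fun hu hv hw => (hu.cross hv).lor hw
  -- A product of analytic functions vanishes on an interval only if one factor does, and `⟨β, β⟩`
  -- does not.
  have hplane : ∀ t ∈ J, vol (β₁ t) (β t) (β₂ t) = 0 :=
    (AnalyticOnNhd.eq_zero_or_eq_zero_of_mul_eq_zero (h.an_β.lor h.an_β)
      (avol h.an_β₁ h.an_β h.an_β₂) h.eq_two h.isPreconnected).resolve_left hg
  have an := h.an_β.cross h.an_β₁
  have hpar := cross_eq_zero_of_parallel h.isOpen h.isPreconnected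
    (v := fun t => cross (β t) (β₁ t)) (v' := fun t => cross (β t) (β₂ t)) an
    (fun t ht => by
      refine ((h.deriv_β t ht).cross (h.deriv_β₁ t ht)).congr_deriv ?_
      apply vec_ext <;> simp [cross] <;> ring)
    (fun t ht => by
      have : vol (β t) (β₁ t) (β₂ t) = -vol (β₁ t) (β t) (β₂ t) := by
        simp only [vol, lor, cross_apply_zero, cross_apply_one, cross_apply_two]
        ring
      rw [cross_cross_cross, this, hplane t ht, neg_zero, neg_zero, zero_smul])
    ht₁ hn
  have hev : ∀ᶠ t in 𝓝 t₁, t ∈ J ∧ cross (β t) (β₁ t) ≠ 0 :=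
    (h.isOpen.eventually_mem ht₁).and ((an t₁ ht₁).continuousAt.eventually_ne hn)
  refine ⟨cross (β t₁) (β₁ t₁), hn, ?_, ?_⟩
  · refine eqOn_of_eventually_eq h.isPreconnected (analyticOnNhd_const.lor h.an_β)
      analyticOnNhd_const ht₁ (hev.mono fun t ht => ?_)
    exact lor_eq_zero_of_parallel ht.2 (hpar t ht.1) (lor_cross_left _ _)
  · rw [or_iff_not_imp_right]
    intro hc
    have hD : ∀ t ∈ J, vol (α₁ t) (β t) (β₁ t) = 0 :=
      (AnalyticOnNhd.eq_zero_or_eq_zero_of_mul_eq_zero (h.an_β.lor h.an_β)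
        (avol h.an_α₁ h.an_β h.an_β₁) (fun t ht => by
          by_contra h0
          exact hc ⟨t, ht, left_ne_zero_of_mul h0, right_ne_zero_of_mul h0⟩)
        h.isPreconnected).resolve_left hg
    refine eqOn_of_eventually_eq h.isPreconnected (analyticOnNhd_const.lor h.an_α₁)
      analyticOnNhd_const ht₁ (hev.mono fun t ht => ?_)
    refine lor_eq_zero_of_parallel ht.2 (hpar t ht.1) ?_
    rw [← hD t ht.1]
    simp only [vol, lor, cross_apply_zero, cross_apply_one, cross_apply_two]
    ring

/-- A null `m` gives Enneper's conjugate and a timelike `m` the first helicoid. For spacelike `m`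
the directors span a Lorentzian plane, and the sign of `⟨β, β⟩` at the generic point decides between
the third and second. The frame contains multiples of `m` and `β t₀`, so the axis is a coordinate
axis and the phase at `t₀` is zero. -/
theorem generic_cases (h : MinimalRuled J K α α₁ α₂ β β₁ β₂) (hK : K.Nonempty)
    (hKc : K.OrdConnected) {m : L3} (hm : m ≠ 0) (hmβ : ∀ t ∈ J, lor m (β t) = 0) {t₀ : ℝ}
    (ht₀ : t₀ ∈ J) (hg : lor (β t₀) (β t₀) ≠ 0) (hD : vol (α₁ t₀) (β t₀) (β₁ t₀) ≠ 0) :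
    (∃ c, c ≠ 0 ∧ CongruentToPart (surfaceOn (ruled α β) (J ×ˢ K)) (helicoid1 c)) ∨
    (∃ c, c ≠ 0 ∧ CongruentToPart (surfaceOn (ruled α β) (J ×ˢ K)) (helicoid2 c)) ∨
    (∃ c, c ≠ 0 ∧ CongruentToPart (surfaceOn (ruled α β) (J ×ˢ K)) (helicoid3 c)) ∨
    (∃ c, c ≠ 0 ∧ CongruentToPart (surfaceOn (ruled α β) (J ×ˢ K)) (conjEnneper2 c)) := by
  have hgen : ∀ {Λ : L3 →ₗ[ℝ] L3}, IsLorentz Λ → lor (Λ (β t₀)) (Λ (β t₀)) ≠ 0 ∧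
      vol (Λ (α₁ t₀)) (Λ (β t₀)) (Λ (β₁ t₀)) ≠ 0 := fun {Λ} hΛ => by
    obtain ⟨d, hd, hv⟩ := hΛ.vol
    rw [hΛ, hv]
    exact ⟨hg, mul_ne_zero hd hD⟩
  have hback : ∀ {Λ : L3 →ₗ[ℝ] L3} {S : ℝ → Set L3}, IsLorentz Λ →
      (∃ c, c ≠ 0 ∧ CongruentToPart
        (surfaceOn (ruled (fun t => Λ (α t)) (fun t => Λ (β t))) (J ×ˢ K)) (S c)) →
      ∃ c, c ≠ 0 ∧ CongruentToPart (surfaceOn (ruled α β) (J ×ˢ K)) (S c) :=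
    fun hΛ ⟨c, hc, hS⟩ => ⟨c, hc, congruentToPart_of_map hΛ hS⟩
  by_cases hmm : lor m m = 0
  · right; right; right
    obtain ⟨Λ, hΛ, k, hk, hΛm⟩ := exists_isLorentz_of_null hm hmm
    refine hback hΛ ((h.map hΛ).conjEnneper2_of_normalized hK (fun t ht => ?_) ht₀ (hgen hΛ).1
      (hgen hΛ).2)
    have := hΛ m (β t)
    rw [hmβ t ht, hΛm, lor_smul_left] at this
    have := (mul_eq_zero.1 this).resolve_left hk
    simp [lor] at this
    linarith
  obtain ⟨k, hk, hkm⟩ := exists_normalize hmm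
  obtain ⟨l, hl, hlβ⟩ := exists_normalize hg
  have hortho : ∀ t ∈ J, lor (k • m) (β t) = 0 := fun t ht => by
    rw [lor_smul_left, hmβ t ht, mul_zero]
  have hortho' : lor (k • m) (l • β t₀) = 0 := by rw [lor_smul_right, hortho t₀ ht₀, mul_zero]
  have hthird : lor (cross (k • m) (l • β t₀)) (β t₀) = 0 := by
    have := lor_cross_right (k • m) (l • β t₀)
    rw [lor_smul_right] at this
    exact (mul_eq_zero.1 this).resolve_left hl
  have hnorm := lor_cross_self (k • m) (l • β t₀)
  rw [gram, hortho'] at hnorm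
  have hcl := lor_cross_left (k • m) (l • β t₀)
  have hcr := lor_cross_right (k • m) (l • β t₀)
  rcases lt_or_gt_of_ne hmm with hneg | hpos
  · left
    have hβ := lor_pos_of_timelike hneg (hmβ t₀ ht₀) hg
    simp only [sign_neg hneg, sign_pos hβ, SignType.coe_neg_one, SignType.coe_one] at hkm hlβ
    rw [hkm, hlβ] at hnorm
    obtain ⟨Λ, hΛ, hx⟩ := exists_isLorentz_of_frame hkm hlβ (hnorm.trans (by norm_num)) hortho'
      ((lor_comm _ _).trans hcl) ((lor_comm _ _).trans hcr)
    exact hback hΛ ((h.map hΛ).helicoid1_of_normalized hK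
      (fun t ht => by rw [(hx _).1, hortho t ht, neg_zero]) ht₀ (by rw [(hx _).2.2, hthird])
      (hgen hΛ).1 (hgen hΛ).2)
  · right
    rcases lt_or_gt_of_ne hg with hβ | hβ
    · right; left
      simp only [sign_pos hpos, sign_neg hβ, SignType.coe_neg_one, SignType.coe_one] at hkm hlβ
      rw [hkm, hlβ] at hnorm
      obtain ⟨Λ, hΛ, hx⟩ := exists_isLorentz_of_frame hlβ hkm (hnorm.trans (by norm_num))
        ((lor_comm _ _).trans hortho') ((lor_comm _ _).trans hcr) ((lor_comm _ _).trans hcl)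
      exact hback hΛ ((h.map hΛ).helicoid3_of_normalized hK
        (fun t ht => by rw [(hx _).2.1, hortho t ht]) ht₀ (by rw [(hx _).2.2, hthird])
        (hgen hΛ).1 (hgen hΛ).2)
    · left
      simp only [sign_pos hpos, sign_pos hβ, SignType.coe_one] at hkm hlβ
      rw [hkm, hlβ] at hnorm
      obtain ⟨Λ, hΛ, hx⟩ := exists_isLorentz_of_frame (hnorm.trans (by norm_num)) hlβ hkm
        hcr hcl ((lor_comm _ _).trans hortho')
      exact hback hΛ ((h.map hΛ).helicoid2_of_normalized hK hKc
        (fun t ht => by rw [(hx _).2.2, hortho t ht]) ht₀ (by rw [(hx _).1, hthird, neg_zero])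
        (hgen hΛ).1 (hgen hΛ).2)

end MinimalRuled

/-! ### From vanishing mean curvature to polynomial identities -/

theorem eq_zero_of_quadratic {K : Set ℝ} (hK : IsOpen K) (hKn : K.Nonempty) {a b c : ℝ}
    (h : ∀ s ∈ K, a + b * s + c * s ^ 2 = 0) : a = 0 ∧ b = 0 ∧ c = 0 := by
  obtain ⟨s, hs⟩ := hKn
  obtain ⟨ε, hε, hb⟩ := Metric.isOpen_iff.1 hK s hs
  have h0 := h s hs
  have h1 := h (s + ε / 2) (hb (by simp [abs_of_pos hε, hε]))
  have h2 := h (s - ε / 2) (hb (by simp [abs_of_pos hε, hε]))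
  have hc : c = 0 := by
    have : ε ^ 2 * c = 0 := by linear_combination 2 * h1 + 2 * h2 - 4 * h0
    exact (mul_eq_zero.1 this).resolve_left (pow_ne_zero 2 hε.ne')
  subst hc
  have hb : b = 0 := by
    have : ε * b = 0 := by linear_combination h1 - h2
    exact (mul_eq_zero.1 this).resolve_left hε.ne'
  subst hb
  exact ⟨by linarith, rfl, rfl⟩

/-- On a timelike surface `X_t × X_s` has positive square, so the normalizing factor of the unit
normal can be cancelled, leaving determinants without square roots. -/
theorem minimal_equation {X : ℝ → ℝ → L3} {t s : ℝ}
    (ht : coefE X t s * coefG X t s - coefF X t s ^ 2 < 0) (h : meanCurvature X t s = 0) :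
    vol (pdT X t s) (pdS X t s) (pdT (pdT X) t s) * coefG X t s
      - 2 * (vol (pdT X t s) (pdS X t s) (pdS (pdT X) t s) * coefF X t s)
      + vol (pdT X t s) (pdS X t s) (pdS (pdS X) t s) * coefE X t s = 0 := by
  rw [meanCurvature, div_eq_zero_iff] at h
  have h := h.resolve_right (mul_ne_zero two_ne_zero ht.ne)
  have hpos : 0 < lor (cross (pdT X t s) (pdS X t s)) (cross (pdT X t s) (pdS X t s)) := by
    rw [lor_cross_self, gram]
    simp only [coefE, coefF, coefG] at ht
    linarith
  simp only [unitNormal, lor_smul_right] at h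
  refine mul_left_cancel₀ (inv_ne_zero (Real.sqrt_pos.2 hpos).ne') ?_
  rw [mul_zero, ← h]
  simp only [vol, lor_comm (cross (pdT X t s) (pdS X t s))]
  ring

theorem minimalRuled_of_isMinimalOn {J K : Set ℝ} (hJ : IsOpen J) (hJ' : J.OrdConnected)
    (hK : IsOpen K) (hKn : K.Nonempty) {α β : ℝ → L3} (hα : AnalyticOnNhd ℝ α J)
    (hβ : AnalyticOnNhd ℝ β J) (htime : IsTimelikeOn (ruled α β) (J ×ˢ K))
    (hmin : IsMinimalOn (ruled α β) (J ×ˢ K)) :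
    MinimalRuled J K α (deriv α) (deriv (deriv α)) β (deriv β) (deriv (deriv β)) := by
  have dd : ∀ {u : ℝ → L3}, AnalyticOnNhd ℝ u J → ∀ t ∈ J, HasDerivAt u (deriv u t) t :=
    fun hu t ht => (hu t ht).differentiableAt.hasDerivAt
  have hα' : AnalyticOnNhd ℝ (deriv α) J := fun t ht => (hα t ht).deriv
  have hβ' : AnalyticOnNhd ℝ (deriv β) J := fun t ht => (hβ t ht).deriv
  have hβ'' : AnalyticOnNhd ℝ (deriv (deriv β)) J := fun t ht => (hβ' t ht).deriv
  have hT : ∀ t ∈ J, ∀ s, pdT (ruled α β) t s = deriv α t + s • deriv β t := fun t ht s =>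
    ((dd hα t ht).add ((dd hβ t ht).const_smul s)).deriv
  have hline : ∀ (a b : L3) (s : ℝ), HasDerivAt (fun s : ℝ => a + s • b) b s := fun a b s => by
    simpa using! ((hasDerivAt_id s).smul_const b).const_add a
  have hS : pdS (ruled α β) = fun t _ => β t := funext fun t => funext fun s =>
    (hline (α t) (β t) s).deriv
  have hSS : ∀ t s, pdS (pdS (ruled α β)) t s = 0 := fun t s => by
    rw [hS]
    simp [pdS]
  have hST : ∀ t ∈ J, ∀ s, pdS (pdT (ruled α β)) t s = deriv β t := fun t ht s => by
    have : (fun s => pdT (ruled α β) t s) = fun s => deriv α t + s • deriv β t :=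
      funext fun s => hT t ht s
    rw [pdS, this]
    exact (hline _ _ s).deriv
  have hTT : ∀ t ∈ J, ∀ s, pdT (pdT (ruled α β)) t s =
      deriv (deriv α) t + s • deriv (deriv β) t := fun t ht s => by
    have : (fun t => pdT (ruled α β) t s) =ᶠ[𝓝 t] fun t => deriv α t + s • deriv β t :=
      (hJ.eventually_mem ht).mono fun r hr => hT r hr s
    rw [pdT, this.deriv_eq]
    exact ((dd hα' t ht).add ((dd hβ' t ht).const_smul s)).deriv
  have hgram : ∀ t ∈ J, ∀ s ∈ K, gram (deriv α t + s • deriv β t) (β t) < 0 := fun t ht s hs => by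
    have := htime (t, s) ⟨ht, hs⟩
    simpa only [gram, coefE, coefF, coefG, hT t ht, hS] using this
  have hquad := fun t (ht : t ∈ J) => eq_zero_of_quadratic hK hKn
    (a := vol (deriv α t) (β t) (deriv (deriv α) t) * lor (β t) (β t) -
      2 * (vol (deriv α t) (β t) (deriv β t) * lor (deriv α t) (β t)))
    (b := (vol (deriv α t) (β t) (deriv (deriv β) t) +
        vol (deriv β t) (β t) (deriv (deriv α) t)) * lor (β t) (β t) -
      2 * (vol (deriv α t) (β t) (deriv β t) * lor (deriv β t) (β t)))
    (c := vol (deriv β t) (β t) (deriv (deriv β) t) * lor (β t) (β t)) fun s hs => by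
      have h1 := minimal_equation (htime (t, s) ⟨ht, hs⟩) (hmin (t, s) ⟨ht, hs⟩)
      simp only [hSS] at h1
      simp only [coefE, coefF, coefG, hT t ht, hS, hTT t ht, hST t ht] at h1
      have e1 : ∀ a b c d e : L3, vol (a + s • b) c (d + s • e) =
          vol a c d + (vol a c e + vol b c d) * s + vol b c e * s ^ 2 := fun a b c d e => by
        simp only [vol, lor, cross_apply_zero, cross_apply_one, cross_apply_two, Pi.add_apply,
          Pi.smul_apply, smul_eq_mul]
        ring
      have e2 : ∀ a b c : L3, vol (a + s • b) c b = vol a c b := fun a b c => by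
        simp only [vol, lor, cross_apply_zero, cross_apply_one, cross_apply_two, Pi.add_apply,
          Pi.smul_apply, smul_eq_mul]
        ring
      have e3 : ∀ a b : L3, vol a b 0 = 0 := fun a b => by simp [vol, lor]
      rw [e1, e2, e3, lor_add_left, lor_smul_left] at h1
      linear_combination h1
  refine ⟨hJ, hJ', hα, hα', hβ, hβ', hβ'', dd hα, dd hα', dd hβ, dd hβ', hgram,
    fun t ht => ?_, fun t ht => ?_, fun t ht => ?_⟩
  · linear_combination (hquad t ht).2.2
  · have e : vol (deriv β t) (β t) (deriv (deriv α) t) =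
        -vol (deriv (deriv α) t) (β t) (deriv β t) := by
      simp only [vol, lor, cross_apply_zero, cross_apply_one, cross_apply_two]
      ring
    have := (hquad t ht).2.1
    rw [e, lor_comm (deriv β t)] at this
    linear_combination this
  · linear_combination (hquad t ht).1

end LorentzMinkowski

theorem mainTheorem5
    (J₁ J₂ : Set ℝ) (hJ₁ : IsOpen J₁) (hJ₁' : J₁.OrdConnected)
    (hJ₂ : IsOpen J₂) (hJ₂' : J₂.OrdConnected)
    (α β : ℝ → L3) (hα : AnalyticOnNhd ℝ α J₁) (hβ : AnalyticOnNhd ℝ β J₁)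
    (htime : IsTimelikeOn (ruled α β) (J₁ ×ˢ J₂))
    (hmin : IsMinimalOn (ruled α β) (J₁ ×ˢ J₂)) :
    (∃ P, IsLorentzianPlane P ∧ CongruentToPart (surfaceOn (ruled α β) (J₁ ×ˢ J₂)) P) ∨
    (∃ c, c ≠ 0 ∧ CongruentToPart (surfaceOn (ruled α β) (J₁ ×ˢ J₂)) (helicoid1 c)) ∨
    (∃ c, c ≠ 0 ∧ CongruentToPart (surfaceOn (ruled α β) (J₁ ×ˢ J₂)) (helicoid2 c)) ∨
    (∃ c, c ≠ 0 ∧ CongruentToPart (surfaceOn (ruled α β) (J₁ ×ˢ J₂)) (helicoid3 c)) ∨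
    (∃ c, c ≠ 0 ∧ CongruentToPart (surfaceOn (ruled α β) (J₁ ×ˢ J₂)) (conjEnneper2 c)) ∨
    (∃ S, IsFlatBScroll S ∧ CongruentToPart (surfaceOn (ruled α β) (J₁ ×ˢ J₂)) S) := by
  -- The intervals may be empty; the empty surface lies in any Lorentzian plane.
  rcases (J₁ ×ˢ J₂).eq_empty_or_nonempty with hempty | hne
  · refine Or.inl ⟨_, ⟨0, ![1, 0, 0], ![0, 1, 0], by simp [lor], rfl⟩,
      congruentToPart_of_subset ?_⟩
    simp [surfaceOn, hempty]
  obtain ⟨hJ, hK⟩ := Set.prod_nonempty_iff.1 hne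
  have h := minimalRuled_of_isMinimalOn hJ₁ hJ₁' hJ₂ hK hα hβ htime hmin
  by_cases hc : ∀ t ∈ J₁, cross (β t) (deriv β t) = 0
  · rcases h.cylinder hJ hK hc with hp | hs
    · exact Or.inl hp
    · exact Or.inr (Or.inr (Or.inr (Or.inr (Or.inr hs))))
  push Not at hc
  obtain ⟨t₁, ht₁, hn⟩ := hc
  obtain ⟨m, hm, hmβ, hmα | ⟨t₀, ht₀, hg, hD⟩⟩ := h.exists_normal hK ht₁ hn
  · exact Or.inl (h.planar hJ hK hm hmα hmβ)
  · rcases h.generic_cases hK hJ₂' hm hmβ ht₀ hg hD with h1 | h2 | h3 | h4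
    · exact Or.inr (Or.inl h1)
    · exact Or.inr (Or.inr (Or.inl h2))
    · exact Or.inr (Or.inr (Or.inr (Or.inl h3)))
    · exact Or.inr (Or.inr (Or.inr (Or.inr (Or.inl h4))))
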